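/- **Definitions.** Circuits are in negation normal form: finite directed acyclic graphs whose sources are labelled by constants or literals, whose other gates are $\wedge$- or $\vee$-gates, and whose unique sink is the output gate. The *size* of a circuit is its number of arcs. For a gate $g$, $C_g$ is the subcircuit with output gate $g$. A *vtree* is a rooted, full, ordered binary tree whose leaves correspond bijectively to a nonempty finite set of variables; this set may strictly contain the variables of the circuits considered. For an internal node $v$ of a vtree $T$, let $v_l, v_r$ be its left and right child and $T_u$ the subtree rooted at $u$. A *sentential decision diagram (SDD)* respecting $T$ is a circuit that is a single constant gate, or a single literal gate on a variable of $T$, or of the form $\bigvee_{i=1}^k (C_{p_i}\wedge C_{s_i})$ with $k\ge 2$ such that, for some internal node $v$ of $T$: each $C_{p_i}$ is an SDD respecting a subtree of $T_{v_l}$, each $C_{s_i}$ is an SDD respecting a subtree of $T_{v_r}$, $C_{p_i}\not\equiv\bot$ for all $i$, $C_{p_i}\wedge C_{p_j}\equiv\bot$ for $i\neq j$, and $\bigvee_i C_{p_i}\equiv\top$. It is *compressed* if at each of its $\vee$-gates, so decomposed, the $C_{s_i}$ are pairwise inequivalent. An *OBDD* is a compressed SDD respecting a right-linear vtree (every left child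 is a leaf), and so respecting the variable ordering given by the leaves from left to right. The *compressed SDD size* (*OBDD size*) of a boolean function is the minimum size of a compressed SDD (OBDD) on its variables that computes it, over all vtrees (over all right-linear vtrees, i.e. all variable orderings). For $m\in\mathbb{N}$ and $0\le i\le m$ let $E^i_m(x_1,\dots,x_m)$ be true if and only if exactly $i$ of $x_1,\dots,x_m$ are true. The *generalized hidden weighted bit function* $F_m$ is the boolean function of the $n=2m+1$ variables $x_1,\dots,x_m,y_0,y_1,\dots,y_m$ given by $$F_m \equiv (E^0_m\wedge\neg y_0)\vee(E^m_m\wedge y_m)\vee\bigvee_{i=1}^{m-1}\bigl((E^i_m\wedge\neg x_i\wedge\neg y_i)\vee(E^i_m\wedge x_i\wedge y_i)\bigr).$$ **Theorem.** The functions $F_m$ have arity $n=2m+1$ (so the family has unbounded arity), and there are constants $K\in\mathbb{N}$ and $c>0$ such that 1. for every $m\ge 0$, the compressed SDD size of $F_m$ is at most $K n^3$, where $n=2m+1$; 2. for every $m\ge 1$, the OBDD size of $F_m$ is at least $2^{cn}$, where $n=2m+1$. That is, $F_m$ has compressed SDD size $O(n^3)$ and OBDD size $2^{\Omega(n)}$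 under every variable ordering. -/

import Mathlib

open scoped ENNReal

/-! ### Boolean functions -/

/-- A boolean function on a finite set `vars` of variables drawn from a supply `V`. It is evaluated
on assignments of the whole supply, and depends only on the values given to `vars`. -/
structure BoolFun (V : Type) where
  vars : Finset V
  toFun : (V → Bool) → Bool
  dependsOn : DependsOn toFun (vars : Set V)

/-- The arity: the number of variables. -/
def BoolFun.arity {V : Type} (f : BoolFun V) : ℕ := f.vars.card

/-! ### Circuits in negation normal form -/

/-- Gate labels: constants, literals (`lit v true` is `v`, `lit v false` is `¬ v`),
conjunction, disjunction. -/
inductive GateLabel (V : Type) where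
  | const (b : Bool)
  | lit (v : V) (b : Bool)
  | conj
  | disj

/-- The labels of input gates: constants and literals. -/
def GateLabel.IsInput {V : Type} : GateLabel V → Prop
  | .const _ => True
  | .lit _ _ => True
  | .conj => False
  | .disj => False

/-- A circuit in negation normal form: a finite directed acyclic graph of gates.
`wires g` is the set of the gates from which a wire enters `g`. The sources are exactly the input
gates, and the output gate is the unique sink. -/
structure NNF (V : Type) where
  Gate : Type
  fintypeGate : Fintype Gate
  label : Gate → GateLabel V
  wires : Gate → Finset Gate
  output : Gate
  acyclic : WellFounded (fun h g : Gate => h ∈ wires g)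
  source_iff : ∀ g, wires g = ∅ ↔ (label g).IsInput
  sink_iff : ∀ g, (∀ h, g ∉ wires h) ↔ g = output

attribute [instance] NNF.fintypeGate

namespace NNF

variable {V : Type}

/-- The size of a circuit: the number of arcs of its directed acyclic graph. -/
def size (C : NNF V) : ℕ := ∑ g : C.Gate, (C.wires g).card

open Classical in
/-- The value, under the assignment `a`, of the subcircuit whose output gate is `g`. -/
noncomputable def eval (C : NNF V) (a : V → Bool) : C.Gate → Bool :=
  C.acyclic.fix fun g ih =>
    match C.label g with
    | .const b => b
    | .lit v b => a v == b
    | .conj => decide (∀ (h : C.Gate) (hh : h ∈ C.wires g), ih h hh = true)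
    | .disj => decide (∃ (h : C.Gate) (hh : h ∈ C.wires g), ih h hh = true)

open Classical in
theorem eval_eq (C : NNF V) (a : V → Bool) (g : C.Gate) :
    C.eval a g =
      match C.label g with
      | .const b => b
      | .lit v b => a v == b
      | .conj => decide (∀ h ∈ C.wires g, C.eval a h = true)
      | .disj => decide (∃ h ∈ C.wires g, C.eval a h = true) := by
  unfold eval
  rw [WellFounded.fix_eq]
  cases C.label g <;> simp

/-- `C` is a circuit on the input variables `f.vars` (not all of them need to be read)
that computes `f`. -/
def Computes (C : NNF V) (f : BoolFun V) : Prop :=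
  (∀ g v b, C.label g = .lit v b → v ∈ f.vars) ∧
    ∀ a : V → Bool, C.eval a C.output = f.toFun a

end NNF

/-! ### Variable trees -/

/-- Rooted, full, ordered binary trees with leaves labelled in `V`. -/
inductive VTree (V : Type) where
  | leaf (v : V)
  | node (l r : VTree V)

namespace VTree

variable {V : Type}

/-- The leaves, from left to right. -/
def leaves : VTree V → List V
  | leaf v => [v]
  | node l r => l.leaves ++ r.leaves

/-- The leaves correspond bijectively to a set of variables. -/
def IsVTree (T : VTree V) : Prop := T.leaves.Nodup

/-- `IsSubtree S T`: `S` is the subtree of `T` rooted at some node of `T`. -/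
inductive IsSubtree : VTree V → VTree V → Prop
  | refl (T : VTree V) : IsSubtree T T
  | left {S l r : VTree V} : IsSubtree S l → IsSubtree S (node l r)
  | right {S l r : VTree V} : IsSubtree S r → IsSubtree S (node l r)

/-- Every left child is a leaf. -/
def RightLinear : VTree V → Prop
  | leaf _ => True
  | node l r => (∃ v, l = leaf v) ∧ r.RightLinear

end VTree

/-! ### Sentential decision diagrams -/

namespace NNF

variable {V : Type}

/-- `C.SDDAt compressed g T`: the subcircuit of `C` with output gate `g` is a sentential decision
diagram (SDD) respecting the vtree `T`; if `compressed` is `true`, it is moreover a compressed one.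
In `decision`, `node L R` is the subtree of `T` at the internal node which `g` respects; the
`∧`-gate `h` has wires from its prime `p h` and its sub `s h`. Since a prime mentions only variables
of `L`, and a sub only variables of `R`, equivalence may be tested on assignments of all variables.
-/
inductive SDDAt (C : NNF V) (compressed : Bool) : C.Gate → VTree V → Prop
  | literal (g : C.Gate) (T : VTree V) (v : V) (b : Bool)
      (label_eq : C.label g = .lit v b) (mem : v ∈ T.leaves) : SDDAt C compressed g T
  | constant (g : C.Gate) (T : VTree V) (b : Bool)
      (label_eq : C.label g = .const b) : SDDAt C compressed g T
  | decision (g : C.Gate) (T L R : VTree V) (p s : C.Gate → C.Gate) (Tp Ts : C.Gate → VTree V)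
      (label_eq : C.label g = .disj)
      (subtree : (VTree.node L R).IsSubtree T)
      (two_le : 2 ≤ (C.wires g).card)
      (label_conj : ∀ h ∈ C.wires g, C.label h = .conj)
      (wires_conj : ∀ h ∈ C.wires g, p h ≠ s h ∧ (C.wires h : Set C.Gate) = {p h, s h})
      (prime_subtree : ∀ h ∈ C.wires g, (Tp h).IsSubtree L)
      (prime_sdd : ∀ h ∈ C.wires g, SDDAt C compressed (p h) (Tp h))
      (sub_subtree : ∀ h ∈ C.wires g, (Ts h).IsSubtree R)
      (sub_sdd : ∀ h ∈ C.wires g, SDDAt C compressed (s h) (Ts h))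
      (prime_ne_bot : ∀ h ∈ C.wires g, ∃ a, C.eval a (p h) = true)
      (prime_disjoint : ∀ h ∈ C.wires g, ∀ h' ∈ C.wires g, h ≠ h' →
        ∀ a, ¬ (C.eval a (p h) = true ∧ C.eval a (p h') = true))
      (prime_cover : ∀ a, ∃ h ∈ C.wires g, C.eval a (p h) = true)
      (sub_ne : compressed = true → ∀ h ∈ C.wires g, ∀ h' ∈ C.wires g, h ≠ h' →
        ∃ a, C.eval a (s h) ≠ C.eval a (s h')) :
      SDDAt C compressed g T

/-- `C` is an SDD respecting `T`. -/
def IsSDD (C : NNF V) (T : VTree V) : Prop := T.IsVTree ∧ C.SDDAt false C.output T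

/-- `C` is a compressed SDD respecting `T`. -/
def IsCompressedSDD (C : NNF V) (T : VTree V) : Prop := T.IsVTree ∧ C.SDDAt true C.output T

/-- `C` is an ordered binary decision diagram (OBDD): a compressed SDD respecting some right-linear
vtree, hence some variable ordering (the left to right order of the leaves). -/
def IsOBDD (C : NNF V) : Prop := ∃ T : VTree V, T.RightLinear ∧ C.IsCompressedSDD T

end NNF

namespace BoolFun

variable {V : Type}

/-- The compressed SDD size of `f`: the minimum size of a compressed SDD (respecting any vtree)
that computes `f`. -/
noncomputable def compressedSDDSize (f : BoolFun V) : ℕ∞ :=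
  ⨅ (C : NNF V) (_ : ∃ T : VTree V, C.IsCompressedSDD T) (_ : C.Computes f), (C.size : ℕ∞)

/-- The OBDD size of `f`: the minimum size of an OBDD (respecting any variable ordering) that
computes `f`. -/
noncomputable def obddSize (f : BoolFun V) : ℕ∞ :=
  ⨅ (C : NNF V) (_ : C.IsOBDD) (_ : C.Computes f), (C.size : ℕ∞)

end BoolFun

/-! ### The generalized hidden weighted bit function -/

namespace GHWB

/-- The supply of variables `x 0, x 1, …` and `y 0, y 1, …`. -/
abbrev Var : Type := ℕ ⊕ ℕ

/-- The variable `x i`. -/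
abbrev x (i : ℕ) : Var := Sum.inl i

/-- The variable `y i`. -/
abbrev y (i : ℕ) : Var := Sum.inr i

/-- The set of variables `x 1, …, x m, y 0, y 1, …, y m`. -/
def vars (m : ℕ) : Finset Var := (Finset.Icc 1 m).disjSum (Finset.range (m + 1))

/-- `E m i`: exactly `i` of the variables `x 1, …, x m` are true. -/
def E (m i : ℕ) (a : Var → Bool) : Prop :=
  ((Finset.Icc 1 m).filter fun j => a (x j) = true).card = i

/-- The formula
`(P_0 ∧ ¬ y_0) ∨ (P_m ∧ y_m) ∨ ⋁_{i = 1, …, m - 1} ((P_{i,0} ∧ ¬ y_i) ∨ (P_{i,1} ∧ y_i))`,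
where `P_0 = E m 0`, `P_m = E m m`, `P_{i,0} = E m i ∧ ¬ x_i` and `P_{i,1} = E m i ∧ x_i`. -/
def Formula (m : ℕ) (a : Var → Bool) : Prop :=
  (E m 0 a ∧ a (y 0) = false) ∨ (E m m a ∧ a (y m) = true) ∨
    ∃ i : ℕ, 1 ≤ i ∧ i ≤ m - 1 ∧
      (((E m i a ∧ a (x i) = false) ∧ a (y i) = false) ∨
        ((E m i a ∧ a (x i) = true) ∧ a (y i) = true))

theorem formula_congr (m : ℕ) {a b : Var → Bool} (h : ∀ v ∈ vars m, a v = b v) :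
    Formula m a ↔ Formula m b := by
  have hx : ∀ i, 1 ≤ i → i ≤ m → a (x i) = b (x i) := fun i h1 h2 =>
    h _ (by simp [vars, h1, h2])
  have hy : ∀ i, i ≤ m → a (y i) = b (y i) := fun i h1 =>
    h _ (by simp [vars]; omega)
  have hE : ∀ i, E m i a ↔ E m i b := by
    intro i
    unfold E
    rw [Finset.filter_congr (q := fun j => b (x j) = true)]
    intro j hj
    rw [Finset.mem_Icc] at hj
    rw [hx j hj.1 hj.2]
  unfold Formula
  rw [hE 0, hE m, hy 0 (Nat.zero_le m), hy m le_rfl]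
  refine or_congr_right (or_congr_right (exists_congr fun i => ?_))
  refine and_congr_right fun h1 => and_congr_right fun h2 => ?_
  rw [hE i, hx i h1 (by omega), hy i (by omega)]

open Classical in
/-- The generalized hidden weighted bit function `F m` of the variables
`x 1, …, x m, y 0, y 1, …, y m`. -/
noncomputable def F (m : ℕ) : BoolFun Var where
  vars := vars m
  toFun a := decide (Formula m a)
  dependsOn _ _ h := decide_eq_decide.mpr (formula_congr m h)

end GHWB

/-! Upper bound. Take a vtree whose root separates the x-variables from the y-variables, both sides
being right-linear. The functions $E^0_m$, $E^m_m$, $E^i_m\wedge\neg x_i$ and $E^i_m\wedge x_i$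
($1\le i<m$) partition the assignments of the x-variables, and they serve as the primes of one
decision at the root. Their subs are the pairwise inequivalent literals $\neg y_0$, $y_m$, $\neg
y_i$, $y_i$. Each prime is a counting automaton that reads $x_1,\dots,x_m$ and remembers only the
number of ones so far, so it has $O(m^2)$ states; $O(m)$ primes give $O(m^3)$ arcs. At a satisfiable
state the two successors are disjoint and not both unsatisfiable, hence inequivalent: the diagram is
compressed. `SDDSystem` turns such a table of nodes into an actual circuit.

Lower bound. Fixing the variables in a prefix of the ordering turns an OBDD into one of its gates or
a constant (`NNF.SDDAt.exists_residual`), so the number of distinct subfunctions is at most the size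
plus 3 (`NNF.SDDAt.card_le_size`). With all $y_i$ true and $i$ ones among the x-variables, $0<i<m$,
the value of $F_m$ is $x_i$. Cut the ordering where $4t$ of the x-variables are unread, $t\approx
m/10$. Some window of $4t$ consecutive indices contains a set $K$ of $2t$ read ones. The $t$-subsets
of $K$, padded by a fixed set of read variables, have so many ones that the unread variables can
raise the total to any index $i$ of the window. Two different subsets are told apart by an $i$ in
one and not in the other. Hence there are $\binom{2t}{t}\ge 2^t$ subfunctions
(`GHWB.two_pow_le_size`). -/

/-! ### Compressed SDDs from systems of decisions -/

/-- The description of a node of an SDD: a constant, a literal, or a decision given by its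
elements, the pairs of a prime and a sub. -/
inductive SDDNode (V G : Type) where
  | const (b : Bool)
  | lit (v : V) (b : Bool)
  | decision (E : Finset (G × G))

/-- A system of nodes with their vtrees and the functions they compute, from which a compressed SDD
can be assembled. The conditions are imposed on the finite set `nodes` only. -/
structure SDDSystem (V G : Type) where
  kind : G → SDDNode V G
  tree : G → VTree V
  sem : G → (V → Bool) → Bool
  rank : G → ℕ
  nodes : Finset G
  root : G
  root_mem : root ∈ nodes
  const_sem : ∀ g ∈ nodes, ∀ b, kind g = .const b → ∀ a, sem g a = b
  lit_mem : ∀ g ∈ nodes, ∀ v b, kind g = .lit v b → v ∈ (tree g).leaves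
  lit_sem : ∀ g ∈ nodes, ∀ v b, kind g = .lit v b → ∀ a, sem g a = (a v == b)
  dec_tree : ∀ g ∈ nodes, ∀ E, kind g = .decision E → ∃ L R, tree g = .node L R ∧
    ∀ e ∈ E, (tree e.1).IsSubtree L ∧ (tree e.2).IsSubtree R
  dec_mem : ∀ g ∈ nodes, ∀ E, kind g = .decision E → ∀ e ∈ E, e.1 ∈ nodes ∧ e.2 ∈ nodes
  dec_ne : ∀ g ∈ nodes, ∀ E, kind g = .decision E → ∀ e ∈ E, e.1 ≠ e.2
  dec_rank : ∀ g ∈ nodes, ∀ E, kind g = .decision E → ∀ e ∈ E,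
    rank e.1 < rank g ∧ rank e.2 < rank g
  dec_two_le : ∀ g ∈ nodes, ∀ E, kind g = .decision E → 2 ≤ E.card
  dec_ne_bot : ∀ g ∈ nodes, ∀ E, kind g = .decision E → ∀ e ∈ E, ∃ a, sem e.1 a = true
  dec_disjoint : ∀ g ∈ nodes, ∀ E, kind g = .decision E → ∀ e ∈ E, ∀ e' ∈ E, e ≠ e' →
    ∀ a, ¬ (sem e.1 a = true ∧ sem e'.1 a = true)
  dec_cover : ∀ g ∈ nodes, ∀ E, kind g = .decision E → ∀ a, ∃ e ∈ E, sem e.1 a = true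
  dec_sub_ne : ∀ g ∈ nodes, ∀ E, kind g = .decision E → ∀ e ∈ E, ∀ e' ∈ E, e ≠ e' →
    ∃ a, sem e.2 a ≠ sem e'.2 a
  dec_sem : ∀ g ∈ nodes, ∀ E, kind g = .decision E → ∀ a, sem g a = true ↔
    ∃ e ∈ E, sem e.1 a = true ∧ sem e.2 a = true

namespace SDDSystem

variable {V G : Type} (S : SDDSystem V G)

/-- The elements of a node (none, unless the node is a decision). -/
def elements (g : G) : Finset (G × G) :=
  match S.kind g with
  | .decision E => E
  | _ => ∅

/-- Labels of the gates: `inl g` is the gate of the node `g`, and `inr e` the `∧`-gate of the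
element `e`. -/
def gateLabel : G ⊕ (G × G) → GateLabel V
  | .inl g => match S.kind g with
    | .const b => .const b
    | .lit v b => .lit v b
    | .decision _ => .disj
  | .inr _ => .conj

open Classical in
/-- Wires between the gates. -/
noncomputable def gateWires : G ⊕ (G × G) → Finset (G ⊕ (G × G))
  | .inl g => (S.elements g).image .inr
  | .inr e => {.inl e.1, .inl e.2}

/-- Reachability from the root. -/
def Reach : G ⊕ (G × G) → Prop :=
  Relation.ReflTransGen (fun g h => h ∈ S.gateWires g) (.inl S.root)

theorem kind_of_mem_elements {g : G} {e : G × G} (h : e ∈ S.elements g) :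
    S.kind g = .decision (S.elements g) := by
  unfold elements at *
  split at h <;> simp_all

open Classical in
/-- A finite set that contains all the reachable gates. -/
noncomputable def gateSet : Finset (G ⊕ (G × G)) :=
  S.nodes.image .inl ∪ (S.nodes.biUnion S.elements).image .inr

theorem mem_gateSet_of_reach {g : G ⊕ (G × G)} (h : S.Reach g) : g ∈ S.gateSet := by
  classical
  induction h with
  | refl => simp [gateSet, S.root_mem]
  | @tail b c _ hc ih =>
    rcases b with b | e
    · simp only [gateWires, Finset.mem_image] at hc
      obtain ⟨e, he, rfl⟩ := hc
      have hb : b ∈ S.nodes := by simpa [gateSet] using ih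
      simp only [gateSet, Finset.mem_union, Finset.mem_image, Finset.mem_biUnion]
      exact .inr ⟨e, ⟨b, hb, he⟩, rfl⟩
    · have : ∃ g ∈ S.nodes, e ∈ S.elements g := by simpa [gateSet] using ih
      obtain ⟨g, hg, he⟩ := this
      have := S.dec_mem g hg _ (S.kind_of_mem_elements he) e he
      simp only [gateWires, Finset.mem_insert, Finset.mem_singleton] at hc
      rcases hc with rfl | rfl <;> simp [gateSet, this]

theorem mem_nodes_of_reach {g : G} (h : S.Reach (.inl g)) : g ∈ S.nodes := by
  simpa [gateSet] using S.mem_gateSet_of_reach h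

theorem Reach.step {S : SDDSystem V G} {g h : G ⊕ (G × G)} (hg : S.Reach g)
    (hh : h ∈ S.gateWires g) : S.Reach h :=
  Relation.ReflTransGen.tail hg hh

/-- The rank of a gate. -/
def gateRank : G ⊕ (G × G) → ℕ
  -- Doubling leaves an odd value for each `∧`-gate, strictly between its two inputs and every node
  -- that uses it.
  | .inl g => 2 * S.rank g
  | .inr e => 2 * max (S.rank e.1) (S.rank e.2) + 1

theorem gateRank_lt {g h : G ⊕ (G × G)} (hg : S.Reach g) (hh : h ∈ S.gateWires g) :
    S.gateRank h < S.gateRank g := by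
  classical
  rcases g with g | e
  · simp only [gateWires, Finset.mem_image] at hh
    obtain ⟨e, he, rfl⟩ := hh
    have := S.dec_rank g (S.mem_nodes_of_reach hg) _ (S.kind_of_mem_elements he) e he
    simp only [gateRank]
    omega
  · simp only [gateWires, Finset.mem_insert, Finset.mem_singleton] at hh
    rcases hh with rfl | rfl <;> simp only [gateRank] <;> omega

theorem gateRank_le {g : G ⊕ (G × G)} (hg : S.Reach g) :
    S.gateRank g ≤ S.gateRank (.inl S.root) := by
  unfold Reach at hg
  induction hg with
  | refl => exact le_rfl
  | tail h1 h2 ih => exact (S.gateRank_lt h1 h2).le.trans ih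

theorem gateWires_eq_empty {g : G ⊕ (G × G)} (hg : S.Reach g) :
    S.gateWires g = ∅ ↔ (S.gateLabel g).IsInput := by
  classical
  rcases g with g | e
  · cases hk : S.kind g with
    | const b => simp [gateWires, gateLabel, elements, hk, GateLabel.IsInput]
    | lit v b => simp [gateWires, gateLabel, elements, hk, GateLabel.IsInput]
    | decision E =>
      have := S.dec_two_le g (S.mem_nodes_of_reach hg) E hk
      simp only [gateWires, elements, hk, Finset.image_eq_empty, gateLabel, GateLabel.IsInput,
        iff_false]
      rintro rfl
      simp at this
  · simp [gateWires, gateLabel, GateLabel.IsInput]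

open Classical in
/-- The circuit assembled from the system. -/
noncomputable def toNNF : NNF V where
  -- Unreachable gates are dropped so that the root is the only sink.
  Gate := {g // S.Reach g}
  fintypeGate := (Set.Finite.subset S.gateSet.finite_toSet
    fun _ h => S.mem_gateSet_of_reach h).fintype
  label g := S.gateLabel g.1
  wires g := (S.gateWires g.1).subtype S.Reach
  output := ⟨.inl S.root, .refl⟩
  acyclic := Subrelation.wf (r := InvImage (· < ·) fun g : {g // S.Reach g} => S.gateRank g.1)
    (fun {h g} hh => S.gateRank_lt g.2 (Finset.mem_subtype.1 hh)) (InvImage.wf _ wellFounded_lt)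
  source_iff g := by
    rw [← S.gateWires_eq_empty g.2, Finset.eq_empty_iff_forall_notMem,
      Finset.eq_empty_iff_forall_notMem]
    constructor
    · intro h x hx
      exact h ⟨x, g.2.step hx⟩ (Finset.mem_subtype.2 hx)
    · intro h x hx
      exact h x.1 (Finset.mem_subtype.1 hx)
  sink_iff g := by
    constructor
    · intro h
      obtain ⟨g, hg⟩ := g
      rcases Relation.ReflTransGen.cases_tail hg with rfl | ⟨c, hc, hcg⟩
      · rfl
      · exact absurd (Finset.mem_subtype.2 hcg) (h ⟨c, hc⟩)
    · rintro rfl h hh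
      exact absurd (S.gateRank_lt h.2 (Finset.mem_subtype.1 hh)) (S.gateRank_le h.2).not_gt

theorem mem_wires {g h : S.toNNF.Gate} : h ∈ S.toNNF.wires g ↔ h.1 ∈ S.gateWires g.1 := by
  classical
  exact Finset.mem_subtype

/-- The gate of the system underlying a gate of the circuit. -/
def gateVal (g : S.toNNF.Gate) : G ⊕ (G × G) := Subtype.val g

theorem gateVal_injective : Function.Injective S.gateVal := Subtype.val_injective

/-- The function computed at a gate. -/
def gateSem (a : V → Bool) : G ⊕ (G × G) → Bool
  | .inl g => S.sem g a
  | .inr e => S.sem e.1 a && S.sem e.2 a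

theorem eval_toNNF (a : V → Bool) (g : S.toNNF.Gate) : S.toNNF.eval a g = S.gateSem a g.1 := by
  classical
  induction g using S.toNNF.acyclic.induction with
  | _ g ih =>
  rw [NNF.eval_eq]
  have ih' : ∀ h : G ⊕ (G × G), ∀ hh : h ∈ S.gateWires g.1,
      S.toNNF.eval a ⟨h, g.2.step hh⟩ = S.gateSem a h := fun h hh =>
    ih ⟨h, g.2.step hh⟩ (S.mem_wires.2 hh)
  have hall : (∀ h ∈ S.toNNF.wires g, S.toNNF.eval a h = true) ↔
      ∀ h ∈ S.gateWires g.1, S.gateSem a h = true :=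
    ⟨fun H h hh => by rw [← ih' h hh]; exact H _ (S.mem_wires.2 hh),
     fun H h hh => by rw [ih h hh]; exact H _ (S.mem_wires.1 hh)⟩
  have hex : (∃ h ∈ S.toNNF.wires g, S.toNNF.eval a h = true) ↔
      ∃ h ∈ S.gateWires g.1, S.gateSem a h = true :=
    ⟨fun ⟨h, hh, H⟩ => ⟨h.1, S.mem_wires.1 hh, by rwa [← ih h hh]⟩,
     fun ⟨h, hh, H⟩ => ⟨⟨h, g.2.step hh⟩, S.mem_wires.2 hh, by rwa [ih' h hh]⟩⟩
  simp only [hall, hex]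
  clear hall hex ih ih'
  obtain ⟨g, hg⟩ := g
  change (match S.gateLabel g with
    | .const b => b
    | .lit v b => a v == b
    | .conj => decide (∀ h ∈ S.gateWires g, S.gateSem a h = true)
    | .disj => decide (∃ h ∈ S.gateWires g, S.gateSem a h = true)) = S.gateSem a g
  rcases g with g | e
  · have hn := S.mem_nodes_of_reach hg
    cases hk : S.kind g with
    | const b => simp [gateLabel, hk, gateSem, S.const_sem g hn b hk]
    | lit v b => simp [gateLabel, hk, gateSem, S.lit_sem g hn v b hk]
    | decision E =>
      have := S.dec_sem g hn E hk a
      simp only [gateLabel, hk, gateSem, gateWires, elements, Finset.mem_image]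
      rw [Bool.eq_iff_iff, this, decide_eq_true_eq]
      constructor
      · rintro ⟨_, ⟨e, he, rfl⟩, h⟩
        exact ⟨e, he, by simpa [gateSem] using h⟩
      · rintro ⟨e, he, h⟩
        exact ⟨_, ⟨e, he, rfl⟩, by simpa [gateSem] using h⟩
  · simp [gateLabel, gateSem, gateWires]

/-- The prime of an `∧`-gate. -/
noncomputable def prime : S.toNNF.Gate → S.toNNF.Gate
  | ⟨.inr e, h⟩ => ⟨.inl e.1, h.step (by simp [gateWires])⟩
  | g => g

/-- The sub of an `∧`-gate. -/
noncomputable def sub : S.toNNF.Gate → S.toNNF.Gate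
  | ⟨.inr e, h⟩ => ⟨.inl e.2, h.step (by simp [gateWires])⟩
  | g => g

/-- The vtree of a gate (that of its prime, for an `∧`-gate). -/
def gateTree : G ⊕ (G × G) → VTree V
  | .inl g => S.tree g
  | .inr e => S.tree e.1

/-- Induction on a bound for the rank, which drops from a decision to its primes and subs; the
semantic conditions transfer by `eval_toNNF`. -/
theorem sddAt_toNNF (n : ℕ) : ∀ (g : G) (hg : S.Reach (.inl g)), S.rank g < n →
    S.toNNF.SDDAt true ⟨.inl g, hg⟩ (S.tree g) := by
  classical
  induction n with
  | zero => intro _ _ h; omega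
  | succ n ih =>
  intro g hg hr
  have hn := S.mem_nodes_of_reach hg
  have hl : S.toNNF.label ⟨.inl g, hg⟩ = S.gateLabel (.inl g) := rfl
  cases hk : S.kind g with
  | const b => exact .constant _ _ b (by simp [hl, gateLabel, hk])
  | lit v b => exact .literal _ _ v b (by simp [hl, gateLabel, hk]) (S.lit_mem g hn v b hk)
  | decision E =>
    obtain ⟨L, R, htree, hsub⟩ := S.dec_tree g hn E hk
    have hw : ∀ h, h ∈ S.toNNF.wires ⟨.inl g, hg⟩ → ∃ e ∈ E, ∃ he, h = ⟨.inr e, he⟩ := by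
      rintro ⟨h, hh⟩ hm
      have := S.mem_wires.1 hm
      simp only [gateWires, elements, hk, Finset.mem_image] at this
      obtain ⟨e, he, rfl⟩ := this
      exact ⟨e, he, hh, rfl⟩
    have hw' : ∀ e ∈ E, ∃ he, (⟨.inr e, he⟩ : S.toNNF.Gate) ∈ S.toNNF.wires ⟨.inl g, hg⟩ := by
      intro e he
      have hm : Sum.inr e ∈ S.gateWires (.inl g) := by
        simpa [gateWires, elements, hk] using he
      exact ⟨hg.step hm, S.mem_wires.2 hm⟩
    refine .decision _ _ L R S.prime S.sub (fun h => S.gateTree (S.prime h).1)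
      (fun h => S.gateTree (S.sub h).1) (by simp [hl, gateLabel, hk]) (htree ▸ .refl _)
      ?_ ?_ ?_ ?_ ?_ ?_ ?_ ?_ ?_ ?_ ?_
    · refine (S.dec_two_le g hn E hk).trans ?_
      choose f hf using hw'
      rw [← E.card_attach]
      exact Finset.card_le_card_of_injOn (fun e => (⟨.inr e.1, f e.1 e.2⟩ : S.toNNF.Gate))
        (fun e _ => hf e.1 e.2)
        (fun e _ e' _ h => Subtype.ext (Sum.inr_injective (congrArg S.gateVal h)))
    · intro h hh
      obtain ⟨e, he, he', rfl⟩ := hw h hh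
      rfl
    · intro h hh
      obtain ⟨e, he, he', rfl⟩ := hw h hh
      refine ⟨?_, ?_⟩
      · intro h
        exact S.dec_ne g hn E hk e he (Sum.inl_injective (congrArg S.gateVal h))
      · have key (h : S.toNNF.Gate) : S.gateVal h ∈ S.gateWires (.inr e) ↔
            S.gateVal h = .inl e.1 ∨ S.gateVal h = .inl e.2 := by
          simp only [gateWires, Finset.mem_insert, Finset.mem_singleton]
        exact Set.ext fun h => Finset.mem_coe.trans (S.mem_wires.trans ((key h).trans
          (or_congr (S.gateVal_injective.eq_iff (b := S.prime ⟨.inr e, he'⟩))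
            (S.gateVal_injective.eq_iff (b := S.sub ⟨.inr e, he'⟩)))))
    · intro h hh
      obtain ⟨e, he, he', rfl⟩ := hw h hh
      exact (hsub e he).1
    · intro h hh
      obtain ⟨e, he, he', rfl⟩ := hw h hh
      exact ih _ _ (by have := S.dec_rank g hn E hk e he; omega)
    · intro h hh
      obtain ⟨e, he, he', rfl⟩ := hw h hh
      exact (hsub e he).2
    · intro h hh
      obtain ⟨e, he, he', rfl⟩ := hw h hh
      exact ih _ _ (by have := S.dec_rank g hn E hk e he; omega)
    · intro h hh
      obtain ⟨e, he, he', rfl⟩ := hw h hh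
      simp only [eval_toNNF]
      exact S.dec_ne_bot g hn E hk e he
    · intro h hh h' hh' hne a
      obtain ⟨e, he, he', rfl⟩ := hw h hh
      obtain ⟨d, hd, hd', rfl⟩ := hw h' hh'
      simp only [eval_toNNF]
      exact S.dec_disjoint g hn E hk e he d hd (by rintro rfl; exact hne rfl) a
    · intro a
      obtain ⟨e, he, h⟩ := S.dec_cover g hn E hk a
      obtain ⟨he', hm⟩ := hw' e he
      refine ⟨_, hm, ?_⟩
      rw [eval_toNNF]
      exact h
    · intro _ h hh h' hh' hne
      obtain ⟨e, he, he', rfl⟩ := hw h hh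
      obtain ⟨d, hd, hd', rfl⟩ := hw h' hh'
      simp only [eval_toNNF]
      exact S.dec_sub_ne g hn E hk e he d hd (by rintro rfl; exact hne rfl)

/-- An element costs at most three arcs: one from its `∧`-gate and two into it. An `∧`-gate shared
by several nodes is charged to each of them. -/
theorem size_toNNF_le : S.toNNF.size ≤ ∑ g ∈ S.nodes, 3 * (S.elements g).card := by
  classical
  have h1 : S.toNNF.size ≤ ∑ g ∈ S.gateSet, (S.gateWires g).card := by
    calc S.toNNF.size ≤ ∑ g : S.toNNF.Gate, (S.gateWires (S.gateVal g)).card := by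
          refine Finset.sum_le_sum fun g _ => ?_
          exact Finset.card_le_card_of_injOn S.gateVal (fun h hh => S.mem_wires.1 hh)
            S.gateVal_injective.injOn
      _ = ∑ g ∈ (Finset.univ : Finset S.toNNF.Gate).image S.gateVal,
            (S.gateWires g).card := by
          rw [Finset.sum_image S.gateVal_injective.injOn]
      _ ≤ _ := by
          refine Finset.sum_le_sum_of_subset fun g hg => ?_
          obtain ⟨h, -, rfl⟩ := Finset.mem_image.1 hg
          exact S.mem_gateSet_of_reach h.2
  refine h1.trans ?_
  rw [gateSet, Finset.sum_union, Finset.sum_image Sum.inl_injective.injOn,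
    Finset.sum_image Sum.inr_injective.injOn]
  · calc _ ≤ ∑ g ∈ S.nodes, (S.elements g).card + ∑ e ∈ S.nodes.biUnion S.elements, 2 := by
          refine Nat.add_le_add (Finset.sum_le_sum fun g _ => Finset.card_image_le)
            (Finset.sum_le_sum fun e _ => Finset.card_le_two)
      _ ≤ ∑ g ∈ S.nodes, (S.elements g).card + (∑ g ∈ S.nodes, (S.elements g).card) * 2 := by
          rw [Finset.sum_const, smul_eq_mul]
          gcongr
          exact Finset.card_biUnion_le
      _ = _ := by rw [← Finset.mul_sum]; ring
  · rw [Finset.disjoint_left]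
    simp

theorem isCompressedSDD_toNNF (h : (S.tree S.root).IsVTree) :
    S.toNNF.IsCompressedSDD (S.tree S.root) :=
  ⟨h, S.sddAt_toNNF _ S.root .refl (Nat.lt_succ_self _)⟩

theorem compressedSDDSize_le (f : BoolFun V) (h : (S.tree S.root).IsVTree)
    (hsem : ∀ a, S.sem S.root a = f.toFun a)
    (hvars : ∀ g ∈ S.nodes, ∀ v b, S.kind g = .lit v b → v ∈ f.vars) :
    f.compressedSDDSize ≤ ((∑ g ∈ S.nodes, 3 * (S.elements g).card : ℕ) : ℕ∞) := by
  refine (iInf₂_le S.toNNF ⟨_, S.isCompressedSDD_toNNF h⟩).trans ((iInf_le _ ⟨?_, ?_⟩).trans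
    (Nat.cast_le.2 S.size_toNNF_le))
  · rintro ⟨g | e, hg⟩ v b hl
    · have hl : S.gateLabel (.inl g) = .lit v b := hl
      refine hvars g (S.mem_nodes_of_reach hg) v b ?_
      unfold gateLabel at hl
      cases hk : S.kind g <;> simp_all
    · cases hl
  · intro a
    rw [eval_toNNF, ← hsem]
    rfl

end SDDSystem

/-! ### The counting automaton and the cubic upper bound. -/

namespace VTree

variable {V : Type}

/-- The right-linear vtree with the leaves `z k, …, z (k + n)`. -/
def chain (z : ℕ → V) (k : ℕ) : ℕ → VTree V
  | 0 => leaf (z k)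
  | n + 1 => node (leaf (z k)) (chain z (k + 1) n)

theorem leaves_chain (z : ℕ → V) (k n : ℕ) :
    (chain z k n).leaves = (List.range' k (n + 1)).map z := by
  induction n generalizing k with
  | zero => simp [chain, leaves]
  | succ n ih => rw [chain, leaves, ih, List.range'_succ (n := n + 1)]; rfl

theorem isSubtree_leaf {T : VTree V} {v : V} (h : v ∈ T.leaves) : (leaf v).IsSubtree T := by
  induction T with
  | leaf w =>
    rw [leaves, List.mem_singleton] at h
    exact h ▸ .refl _
  | node l r ihl ihr =>
    rw [leaves, List.mem_append] at h
    exact h.elim (fun h => .left (ihl h)) (fun h => .right (ihr h))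

end VTree

namespace GHWB

/-- The number of the variables `x (k + 1), …, x m` that are true. -/
def ones (m k : ℕ) (a : Var → Bool) : ℕ := ((Finset.Ioc k m).filter fun j => a (x j) = true).card

theorem E_iff (m i : ℕ) (a : Var → Bool) : E m i a ↔ ones m 0 a = i := Iff.rfl

theorem ones_self (m : ℕ) (a : Var → Bool) : ones m m a = 0 := by simp [ones]

theorem ones_le (m k : ℕ) (a : Var → Bool) : ones m k a ≤ m :=
  (Finset.card_filter_le _ _).trans (by simp)

theorem ones_succ {m k : ℕ} (h : k < m) (a : Var → Bool) :
    ones m k a = (a (x (k + 1))).toNat + ones m (k + 1) a := by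
  have : Finset.Ioc k m = insert (k + 1) (Finset.Ioc (k + 1) m) := by
    ext j
    simp only [Finset.mem_insert, Finset.mem_Ioc]
    omega
  unfold ones
  rw [this, Finset.filter_insert]
  cases h : a (x (k + 1)) <;> simp [add_comm]

theorem ones_indicator {m : ℕ} {s : Finset ℕ} (hs : s ⊆ Finset.Ioc 0 m) (a : Var → Bool)
    (ha : ∀ j ∈ Finset.Ioc 0 m, a (x j) = true ↔ j ∈ s) : ones m 0 a = s.card := by
  unfold ones
  congr 1
  ext j
  rw [Finset.mem_filter]
  exact ⟨fun h => (ha j h.1).1 h.2, fun h => ⟨hs h, (ha j (hs h)).2 h⟩⟩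

/-- The function of a state: given that `c` of the variables `x 1, …, x k` are true, exactly `t` of
the variables `x 1, …, x m` are; moreover `x t` has the value prescribed by `o`, if any. -/
def stateSem (m t : ℕ) (o : Option Bool) (k c : ℕ) (a : Var → Bool) : Bool :=
  -- The guard `k < t` keeps the constraint only while `x t` is unread; afterwards a violation is
  -- recorded in the counter.
  decide (c + ones m k a = t ∧ (k < t → ∀ b, o = some b → a (x t) = b))

/-- The counter of the state reached by giving `x (k + 1)` the value `v`. A violation of the
constraint on `x t` leads to the unsatisfiable counter value `m + 1`. -/
def next (m t : ℕ) (o : Option Bool) (k c : ℕ) (v : Bool) : ℕ :=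
  if k + 1 = t ∧ o = some (!v) then m + 1 else c + v.toNat

/-- The transition of the automaton on reading `x (k + 1)`. If the value violates the constraint,
both sides are false, because the counter `m + 1` exceeds `t`. -/
theorem stateSem_succ {m t : ℕ} (o : Option Bool) {k : ℕ} (c : ℕ) (hk : k < m) (ht : t ≤ m)
    (a : Var → Bool) :
    stateSem m t o k c a = stateSem m t o (k + 1) (next m t o k c (a (x (k + 1)))) a := by
  unfold stateSem next
  rw [ones_succ hk, decide_eq_decide]
  split_ifs with h
  · obtain ⟨rfl, rfl⟩ := h
    simp only [lt_add_iff_pos_right, zero_lt_one, Option.some.injEq, forall_eq', forall_const]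
    constructor
    · rintro ⟨-, h⟩
      simp at h
    · rintro ⟨h, -⟩
      omega
  · rw [add_assoc]
    refine and_congr_right fun _ => ⟨fun H h' => H (by omega), fun H h' b hb => ?_⟩
    by_cases hkt : k + 1 = t
    · subst hkt hb
      simp only [true_and, Option.some.injEq] at h
      revert h
      cases b <;> cases a (x (k + 1)) <;> simp
    · exact H (by omega) b hb

theorem le_of_stateSem {m t : ℕ} {o : Option Bool} {k c : ℕ} {a : Var → Bool}
    (h : stateSem m t o k c a = true) : c ≤ t := by
  rw [stateSem, decide_eq_true_eq] at h
  omega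

/-- The two successors face the same remaining variables with different counters, so they cannot
both reach `t`. This disjointness is what makes the subs inequivalent. -/
theorem stateSem_next_not {m t : ℕ} {o : Option Bool} {k c : ℕ} {a : Var → Bool} (ht : t ≤ m)
    {v : Bool} (h : stateSem m t o (k + 1) (next m t o k c v) a = true) :
    stateSem m t o (k + 1) (next m t o k c (!v)) a = false := by
  rw [Bool.eq_false_iff]
  intro h'
  rw [stateSem, decide_eq_true_eq] at h h'
  have h1 := h.1
  have h2 := h'.1
  unfold next at h1 h2
  have : (!v).toNat ≠ v.toNat := by cases v <;> simp
  split_ifs at h1 h2 <;> omega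

/-- With only `x m` unread, at most one of its values completes the count, and satisfiability
provides one: the state is a literal. -/
theorem stateSem_last {m t : ℕ} {o : Option Bool} {k c : ℕ} (hk : k + 1 = m) (ht : t ≤ m)
    {a₀ : Var → Bool} (h₀ : stateSem m t o k c a₀ = true) (a : Var → Bool) :
    stateSem m t o k c a = (a (x m) == decide (c + 1 = t)) := by
  have key : ∀ a, stateSem m t o k c a =
      decide (next m t o k c (a (x m)) = t) := by
    intro a
    rw [stateSem_succ o c (by omega) ht, hk, stateSem, ones_self, add_zero]
    exact decide_eq_decide.2 (and_iff_left fun h => by omega)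
  have hn : ∀ v, next m t o k c v = t → next m t o k c v = c + v.toNat := by
    intro v h
    unfold next at *
    split_ifs at * <;> omega
  rw [key, decide_eq_true_eq] at h₀
  have h1 := hn _ h₀
  rw [key]
  by_cases hv : a (x m) = a₀ (x m)
  · rw [hv, h₀]
    rw [h₀] at h1
    cases h : a₀ (x m) <;> simp [h] at h1 ⊢ <;> omega
  · have h2 : next m t o k c (a (x m)) ≠ t := by
      intro h
      have h3 := hn _ h
      rw [h] at h3
      rw [h₀, h3] at h1
      cases h4 : a (x m) <;> cases h5 : a₀ (x m) <;> simp_all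
    rw [h₀] at h1
    cases h4 : a (x m) <;> cases h5 : a₀ (x m) <;> simp_all

/-- The nodes of the compressed SDD for `F m`. -/
inductive Node where
  | lit (v : Var) (b : Bool)
  | state (t : ℕ) (o : Option Bool) (k c : ℕ)
  | root
  deriving DecidableEq

namespace Node

/-- The indices of the elements of the root: `(t, none)` stands for `E m t`, and `(t, some b)` for
`E m t` together with `x t = b`. -/
def rootIndex (m : ℕ) : Finset (ℕ × Option Bool) :=
  {(0, none), (m, none)} ∪ Finset.Icc 1 (m - 1) ×ˢ {some false, some true}

theorem mem_rootIndex {m t : ℕ} {o : Option Bool} : (t, o) ∈ rootIndex m ↔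
    (o = none ∧ (t = 0 ∨ t = m)) ∨ (1 ≤ t ∧ t ≤ m - 1 ∧ ∃ b, o = some b) := by
  rcases o with _ | _ | _ <;> simp [rootIndex]

/-- The element of the root with a given index. -/
def rootElement (j : ℕ × Option Bool) : Node × Node :=
  -- The default of `getD` serves the indices without constraint: it yields `¬ y 0` at `t = 0`, and
  -- `y m` at `t = m` when `m ≥ 1`.
  (state j.1 j.2 0 0, lit (y j.1) (j.2.getD (decide (j.1 ≠ 0))))

theorem rootElement_injective : Function.Injective rootElement := by
  rintro ⟨t, o⟩ ⟨t', o'⟩ h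
  simp only [rootElement, Prod.mk.injEq, state.injEq] at h
  simp [h.1.1, h.1.2.1]

/-- The elements of the decision of a state. -/
def stateElements (m t : ℕ) (o : Option Bool) (k c : ℕ) : Finset (Node × Node) :=
  Finset.univ.image fun v => (lit (x (k + 1)) v, state t o (k + 1) (next m t o k c v))

open Classical in
/-- The description of the nodes. -/
noncomputable def kind (m : ℕ) : Node → SDDNode Var Node
  | lit v b => .lit v b
  | state t o k c =>
    -- An unsatisfiable state has to be a constant: as a decision it would have two equivalent subs.
    if ∃ a, stateSem m t o k c a = true then
      if k + 1 = m then .lit (x m) (decide (c + 1 = t)) else .decision (stateElements m t o k c)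
    else .const false
  | root => .decision ((rootIndex m).image rootElement)

/-- The vtrees of the nodes. -/
def tree (m : ℕ) : Node → VTree Var
  | lit v _ => .leaf v
  -- `chain z k n` has `n + 1` leaves, so for `k < m` this one ends at `x m`.
  | state _ _ k _ => .chain x (k + 1) (m - k - 1)
  | root => .node (.chain x 1 (m - 1)) (.chain y 0 m)

/-- The functions of the nodes. -/
noncomputable def sem (m : ℕ) : Node → (Var → Bool) → Bool
  | lit v b, a => a v == b
  | state t o k c, a => stateSem m t o k c a
  | root, a => (F m).toFun a

/-- The ranks of the nodes. -/
def rank (m : ℕ) : Node → ℕ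
  | lit _ _ => 0
  | state _ _ k _ => m - k
  | root => m + 1

/-- The parameters of the states that are used. -/
def stateIndex (m : ℕ) : Finset ((ℕ × Option Bool) × (ℕ × ℕ)) :=
  -- The last range goes up to `m + 1`, the counter value that signals failure.
  (Finset.range (m + 1) ×ˢ Finset.univ) ×ˢ (Finset.range m ×ˢ Finset.range (m + 2))

/-- The nodes that are used. -/
def nodes (m : ℕ) : Finset Node :=
  insert root (((vars m ×ˢ Finset.univ).image fun p => lit p.1 p.2) ∪
    ((stateIndex m).image fun p => state p.1.1 p.1.2 p.2.1 p.2.2))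

theorem state_mem_nodes {m t : ℕ} {o : Option Bool} {k c : ℕ} :
    state t o k c ∈ nodes m ↔ t ≤ m ∧ k < m ∧ c ≤ m + 1 := by
  simp [nodes, stateIndex, Nat.lt_succ_iff]

theorem lit_mem_nodes {m : ℕ} {v : Var} {b : Bool} : lit v b ∈ nodes m ↔ v ∈ vars m := by
  simp [nodes]

theorem x_mem_vars {m i : ℕ} : x i ∈ vars m ↔ 1 ≤ i ∧ i ≤ m := by
  simp [vars]

theorem y_mem_vars {m i : ℕ} : y i ∈ vars m ↔ i ≤ m := by
  simp [vars]

theorem kind_state_eq_const {m t : ℕ} {o : Option Bool} {k c : ℕ} {b : Bool}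
    (h : kind m (state t o k c) = .const b) : b = false ∧ ∀ a, stateSem m t o k c a = false := by
  simp only [kind] at h
  split_ifs at h with h1
  · simp only [SDDNode.const.injEq] at h
    simp only [not_exists, Bool.not_eq_true] at h1
    exact ⟨h.symm, h1⟩

theorem kind_state_eq_lit {m t : ℕ} {o : Option Bool} {k c : ℕ} {v : Var} {b : Bool}
    (h : kind m (state t o k c) = .lit v b) : (∃ a, stateSem m t o k c a = true) ∧ k + 1 = m ∧
      v = x m ∧ b = decide (c + 1 = t) := by
  simp only [kind] at h
  split_ifs at h with h1 h2
  simp only [SDDNode.lit.injEq] at h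
  exact ⟨h1, h2, h.1.symm, h.2.symm⟩

theorem kind_state_eq_decision {m t : ℕ} {o : Option Bool} {k c : ℕ} {E : Finset (Node × Node)}
    (h : kind m (state t o k c) = .decision E) : (∃ a, stateSem m t o k c a = true) ∧ k + 1 ≠ m ∧
      E = stateElements m t o k c := by
  simp only [kind] at h
  split_ifs at h with h1 h2
  simp only [SDDNode.decision.injEq] at h
  exact ⟨h1, h2, h.symm⟩

theorem mem_stateElements {m t : ℕ} {o : Option Bool} {k c : ℕ} {e : Node × Node} :
    e ∈ stateElements m t o k c ↔
      ∃ v, e = (lit (x (k + 1)) v, state t o (k + 1) (next m t o k c v)) := by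
  simp only [stateElements, Finset.mem_image, Finset.mem_univ, true_and, eq_comm]

theorem kind_decision {m : ℕ} {g : Node} (hg : g ∈ nodes m) {E : Finset (Node × Node)}
    (h : kind m g = .decision E) :
    (g = root ∧ E = (rootIndex m).image rootElement) ∨
    ∃ t o k c, g = state t o k c ∧ t ≤ m ∧ k + 1 < m ∧ c ≤ m ∧ E = stateElements m t o k c ∧
      ∃ a, stateSem m t o k c a = true := by
  cases g with
  | lit v b => cases h
  | root =>
    simp only [kind, SDDNode.decision.injEq] at h
    exact .inl ⟨rfl, h.symm⟩
  | state t o k c =>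
    obtain ⟨⟨a, ha⟩, h2, h3⟩ := kind_state_eq_decision h
    have := state_mem_nodes.1 hg
    have := le_of_stateSem ha
    exact .inr ⟨t, o, k, c, rfl, by omega, by omega, by omega, h3, a, ha⟩

theorem exists_stateSem_zero {m t : ℕ} {o : Option Bool} (h : (t, o) ∈ rootIndex m) :
    ∃ a, stateSem m t o 0 0 a = true := by
  have key : ∀ s : Finset ℕ, s ⊆ Finset.Ioc 0 m → s.card = t →
      (∀ b, o = some b → decide (t ∈ s) = b) → ∃ a, stateSem m t o 0 0 a = true := by
    intro s hs hc hb
    refine ⟨Sum.elim (fun j => decide (j ∈ s)) (fun _ => false), ?_⟩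
    rw [stateSem, decide_eq_true_eq, ones_indicator hs _ (by simp), zero_add]
    exact ⟨hc, fun _ => hb⟩
  rw [mem_rootIndex] at h
  by_cases ho : o = some false
  · subst ho
    have ht : 1 ≤ t ∧ t ≤ m - 1 := by simpa using h
    -- A set of `t` indices that omits `t`; it fits because `t ≤ m - 1`.
    refine key ((Finset.Ioc 0 (t + 1)).erase t) ?_ ?_ ?_
    · intro j hj
      simp only [Finset.mem_erase, Finset.mem_Ioc] at hj ⊢
      omega
    · rw [Finset.card_erase_of_mem (by simp; omega)]
      simp
    · simp
  · have ht : t ≤ m := by omega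
    refine key (Finset.Ioc 0 t) ?_ (by simp) ?_
    · intro j hj
      simp only [Finset.mem_Ioc] at hj ⊢
      omega
    · rintro b rfl
      have hb : b = true := by simpa using ho
      subst hb
      simp at h ⊢
      omega

theorem stateSem_zero {m t : ℕ} {o : Option Bool} {a : Var → Bool} :
    stateSem m t o 0 0 a = true ↔ ones m 0 a = t ∧ (0 < t → ∀ b, o = some b → a (x t) = b) := by
  rw [stateSem, decide_eq_true_eq, zero_add]

/-- The number of ones determines `t`, and then `x t` determines the constraint. -/
theorem rootIndex_unique {m t t' : ℕ} {o o' : Option Bool} (h : (t, o) ∈ rootIndex m)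
    (h' : (t', o') ∈ rootIndex m) {a : Var → Bool} (ha : stateSem m t o 0 0 a = true)
    (ha' : stateSem m t' o' 0 0 a = true) : (t, o) = (t', o') := by
  rw [stateSem_zero] at ha ha'
  obtain ⟨rfl, ha⟩ := ha
  obtain ⟨rfl, ha'⟩ := ha'
  rw [mem_rootIndex] at h h'
  rw [Prod.mk.injEq]
  refine ⟨rfl, ?_⟩
  rcases h with ⟨rfl, h⟩ | ⟨h1, h2, b, rfl⟩ <;> rcases h' with ⟨rfl, h'⟩ | ⟨h1', h2', b', rfl⟩
  · rfl
  · omega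
  · omega
  · rw [← ha (by omega) b rfl, ← ha' (by omega) b' rfl]

theorem exists_rootIndex (m : ℕ) (a : Var → Bool) :
    ∃ j ∈ rootIndex m, stateSem m j.1 j.2 0 0 a = true := by
  have := ones_le m 0 a
  by_cases h : ones m 0 a = 0 ∨ ones m 0 a = m
  · exact ⟨(ones m 0 a, none), mem_rootIndex.2 (.inl ⟨rfl, h⟩), stateSem_zero.2 ⟨rfl, by simp⟩⟩
  · refine ⟨(ones m 0 a, some (a (x (ones m 0 a)))),
      mem_rootIndex.2 (.inr ⟨by omega, by omega, _, rfl⟩), stateSem_zero.2 ⟨rfl, by simp⟩⟩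

theorem formula_iff {m : ℕ} (hm : 1 ≤ m) (a : Var → Bool) : Formula m a ↔
    ∃ j ∈ rootIndex m, stateSem m j.1 j.2 0 0 a = true ∧
      a (y j.1) = j.2.getD (decide (j.1 ≠ 0)) := by
  unfold Formula
  simp only [Prod.exists, mem_rootIndex, stateSem_zero, E_iff]
  constructor
  · rintro (⟨h, hy⟩ | ⟨h, hy⟩ | ⟨i, h1, h2, ⟨⟨h, hx⟩, hy⟩ | ⟨⟨h, hx⟩, hy⟩⟩)
    · exact ⟨0, none, by simp, by simp [h], by simp [hy]⟩
    · exact ⟨m, none, by simp, by simp [h], by simp [hy]; omega⟩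
    · exact ⟨i, some false, by simp [h1, h2], by simp [h, hx], by simp [hy]⟩
    · exact ⟨i, some true, by simp [h1, h2], by simp [h, hx], by simp [hy]⟩
  · rintro ⟨t, o, ⟨rfl, rfl | rfl⟩ | ⟨h1, h2, b, rfl⟩, ⟨h, hx⟩, hy⟩
    · exact .inl ⟨h, by simpa using hy⟩
    · have : t ≠ 0 := by omega
      exact .inr (.inl ⟨h, by simpa [this] using hy⟩)
    · have := hx (by omega) b rfl
      refine .inr (.inr ⟨t, h1, h2, ?_⟩)
      cases b
      · exact .inl ⟨⟨h, this⟩, by simpa using hy⟩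
      · exact .inr ⟨⟨h, this⟩, by simpa using hy⟩

theorem isVTree_tree_root (m : ℕ) : (tree m root).IsVTree := by
  unfold VTree.IsVTree
  rw [tree, VTree.leaves, VTree.leaves_chain, VTree.leaves_chain]
  refine List.Nodup.append (List.Nodup.map Sum.inl_injective List.nodup_range')
    (List.Nodup.map Sum.inr_injective List.nodup_range') ?_
  intro v h h'
  simp only [List.mem_map] at h h'
  obtain ⟨i, -, rfl⟩ := h
  obtain ⟨j, -, h⟩ := h'
  cases h

/-- The system of decisions for `F m`. -/
noncomputable def system (m : ℕ) (hm : 1 ≤ m) : SDDSystem Var Node where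
  kind := kind m
  tree := tree m
  sem := sem m
  rank := rank m
  nodes := nodes m
  root := root
  root_mem := by simp [nodes]
  const_sem g hg b hk a := by
    cases g with
    | lit => cases hk
    | root => cases hk
    | state t o k c =>
      obtain ⟨rfl, h⟩ := kind_state_eq_const hk
      exact h a
  lit_mem g hg v b hk := by
    cases g with
    | lit => cases hk; simp [tree, VTree.leaves]
    | root => cases hk
    | state t o k c =>
      obtain ⟨-, h, rfl, -⟩ := kind_state_eq_lit hk
      subst h
      simp [tree, VTree.chain, VTree.leaves]
  lit_sem g hg v b hk a := by
    cases g with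
    | lit => cases hk; rfl
    | root => cases hk
    | state t o k c =>
      obtain ⟨⟨a₀, h₀⟩, h, rfl, rfl⟩ := kind_state_eq_lit hk
      exact stateSem_last h (state_mem_nodes.1 hg).1 h₀ a
  dec_tree g hg E hk := by
    rcases kind_decision hg hk with ⟨rfl, rfl⟩ | ⟨t, o, k, c, rfl, ht, hkm, hc, rfl, ha⟩
    · refine ⟨_, _, rfl, fun e he => ?_⟩
      obtain ⟨⟨t, o⟩, hj, rfl⟩ := Finset.mem_image.1 he
      refine ⟨.refl _, VTree.isSubtree_leaf ?_⟩
      rw [mem_rootIndex] at hj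
      rw [VTree.leaves_chain]
      refine List.mem_map.2 ⟨t, ?_, rfl⟩
      rw [List.mem_range'_1]
      omega
    · obtain ⟨n, rfl⟩ : ∃ n, m = k + 1 + (n + 1) := ⟨m - k - 2, by omega⟩
      have e1 : k + 1 + (n + 1) - k - 1 = n + 1 := by omega
      have e2 : k + 1 + (n + 1) - (k + 1) - 1 = n := by omega
      refine ⟨.leaf (x (k + 1)), .chain x (k + 1 + 1) n, ?_, fun e he => ?_⟩
      · rw [tree, e1, VTree.chain]
      · obtain ⟨v, rfl⟩ := mem_stateElements.1 he
        refine ⟨.refl _, ?_⟩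
        simp only [tree, e2]
        exact .refl _
  dec_mem g hg E hk e he := by
    rcases kind_decision hg hk with ⟨rfl, rfl⟩ | ⟨t, o, k, c, rfl, ht, hkm, hc, rfl, ha⟩
    · obtain ⟨⟨t, o⟩, hj, rfl⟩ := Finset.mem_image.1 he
      rw [mem_rootIndex] at hj
      exact ⟨state_mem_nodes.2 (by omega), lit_mem_nodes.2 (y_mem_vars.2 (by omega))⟩
    · obtain ⟨v, rfl⟩ := mem_stateElements.1 he
      refine ⟨lit_mem_nodes.2 (x_mem_vars.2 (by omega)), state_mem_nodes.2 ⟨ht, hkm, ?_⟩⟩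
      have := v.toNat_le
      unfold next
      split_ifs <;> omega
  dec_ne g hg E hk e he := by
    rcases kind_decision hg hk with ⟨rfl, rfl⟩ | ⟨t, o, k, c, rfl, ht, hkm, hc, rfl, ha⟩
    · obtain ⟨⟨t, o⟩, hj, rfl⟩ := Finset.mem_image.1 he
      simp [rootElement]
    · obtain ⟨v, rfl⟩ := mem_stateElements.1 he
      simp
  dec_rank g hg E hk e he := by
    rcases kind_decision hg hk with ⟨rfl, rfl⟩ | ⟨t, o, k, c, rfl, ht, hkm, hc, rfl, ha⟩
    · obtain ⟨⟨t, o⟩, hj, rfl⟩ := Finset.mem_image.1 he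
      simp [rootElement, rank]
    · obtain ⟨v, rfl⟩ := mem_stateElements.1 he
      simp only [rank]
      omega
  dec_two_le g hg E hk := by
    rcases kind_decision hg hk with ⟨rfl, rfl⟩ | ⟨t, o, k, c, rfl, ht, hkm, hc, rfl, ha⟩
    · rw [Finset.card_image_of_injective _ rootElement_injective]
      refine Finset.one_lt_card.2 ⟨(0, none), mem_rootIndex.2 (by simp), (m, none),
        mem_rootIndex.2 (by simp), ?_⟩
      simp only [ne_eq, Prod.mk.injEq, and_true]
      omega
    · rw [stateElements, Finset.card_image_of_injective]
      · simp
      · intro v w h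
        simpa using (congrArg Prod.fst h)
  dec_ne_bot g hg E hk e he := by
    rcases kind_decision hg hk with ⟨rfl, rfl⟩ | ⟨t, o, k, c, rfl, ht, hkm, hc, rfl, ha⟩
    · obtain ⟨⟨t, o⟩, hj, rfl⟩ := Finset.mem_image.1 he
      exact exists_stateSem_zero hj
    · obtain ⟨v, rfl⟩ := mem_stateElements.1 he
      exact ⟨fun _ => v, by simp [sem]⟩
  dec_disjoint g hg E hk e he e' he' hne a := by
    rcases kind_decision hg hk with ⟨rfl, rfl⟩ | ⟨t, o, k, c, rfl, ht, hkm, hc, rfl, ha⟩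
    · obtain ⟨⟨t, o⟩, hj, rfl⟩ := Finset.mem_image.1 he
      obtain ⟨⟨t', o'⟩, hj', rfl⟩ := Finset.mem_image.1 he'
      rintro ⟨h, h'⟩
      exact hne (congrArg rootElement (rootIndex_unique hj hj' h h'))
    · obtain ⟨v, rfl⟩ := mem_stateElements.1 he
      obtain ⟨w, rfl⟩ := mem_stateElements.1 he'
      rintro ⟨h, h'⟩
      simp only [sem, beq_iff_eq] at h h'
      subst h h'
      exact hne rfl
  dec_cover g hg E hk a := by
    rcases kind_decision hg hk with ⟨rfl, rfl⟩ | ⟨t, o, k, c, rfl, ht, hkm, hc, rfl, ha⟩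
    · obtain ⟨j, hj, h⟩ := exists_rootIndex m a
      exact ⟨_, Finset.mem_image_of_mem _ hj, h⟩
    · exact ⟨_, mem_stateElements.2 ⟨a (x (k + 1)), rfl⟩, by simp [sem]⟩
  dec_sub_ne g hg E hk e he e' he' hne := by
    rcases kind_decision hg hk with ⟨rfl, rfl⟩ | ⟨t, o, k, c, rfl, ht, hkm, hc, rfl, a, ha⟩
    · obtain ⟨⟨t, o⟩, hj, rfl⟩ := Finset.mem_image.1 he
      obtain ⟨⟨t', o'⟩, hj', rfl⟩ := Finset.mem_image.1 he'
      by_cases h : t = t'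
      · subst h
        refine ⟨fun _ => true, ?_⟩
        rw [mem_rootIndex] at hj hj'
        rcases hj with ⟨rfl, hj⟩ | ⟨h1, h2, b, rfl⟩ <;>
          rcases hj' with ⟨rfl, hj'⟩ | ⟨h1', h2', b', rfl⟩
        · exact absurd rfl hne
        · omega
        · omega
        · have : b ≠ b' := by rintro rfl; exact hne rfl
          revert this
          cases b <;> cases b' <;> simp [rootElement, sem]
      -- The literals are on different variables: `y t` is set to satisfy the first, all other
      -- variables to falsify the second.
      · refine ⟨fun v => if v = y t then o.getD (decide (t ≠ 0)) else !o'.getD (decide (t' ≠ 0)), ?_⟩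
        have : y t' ≠ y t := by simpa using Ne.symm h
        simp only [rootElement, sem, if_true, if_neg this]
        simp
    · obtain ⟨v, rfl⟩ := mem_stateElements.1 he
      obtain ⟨w, rfl⟩ := mem_stateElements.1 he'
      have hvw : w = !v := by
        cases v <;> cases w <;> simp at hne ⊢
      subst hvw
      -- A model of the state satisfies the successor for its own value of `x (k + 1)`, hence
      -- falsifies the other one.
      refine ⟨a, ?_⟩
      rw [stateSem_succ o c (by omega) ht] at ha
      have hb := stateSem_next_not ht ha
      simp only [sem]
      by_cases hv : v = a (x (k + 1))
      · rw [hv, ha, hb]; simp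
      · have hv' : v = !a (x (k + 1)) := by
          revert hv
          cases v <;> cases a (x (k + 1)) <;> simp
        rw [hv', Bool.not_not, ha, hb]; simp
  dec_sem g hg E hk a := by
    rcases kind_decision hg hk with ⟨rfl, rfl⟩ | ⟨t, o, k, c, rfl, ht, hkm, hc, rfl, ha⟩
    · simp only [sem, F, decide_eq_true_eq, formula_iff hm, Finset.mem_image]
      constructor
      · rintro ⟨j, hj, h1, h2⟩
        exact ⟨_, ⟨j, hj, rfl⟩, h1, by simp [rootElement, h2]⟩
      · rintro ⟨_, ⟨j, hj, rfl⟩, h1, h2⟩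
        exact ⟨j, hj, h1, by simpa [rootElement] using h2⟩
    · simp only [sem]
      rw [stateSem_succ o c (by omega) ht]
      constructor
      · intro h
        exact ⟨_, mem_stateElements.2 ⟨a (x (k + 1)), rfl⟩, by simp, h⟩
      · rintro ⟨e, he, h1, h2⟩
        obtain ⟨v, rfl⟩ := mem_stateElements.1 he
        simp only [beq_iff_eq] at h1
        rw [h1]
        exact h2

theorem kind_lit_mem {m : ℕ} {g : Node} (hg : g ∈ nodes m) {v : Var} {b : Bool}
    (hk : kind m g = .lit v b) : v ∈ vars m := by
  cases g with
  | lit => cases hk; exact lit_mem_nodes.1 hg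
  | root => cases hk
  | state t o k c =>
    obtain ⟨-, h, rfl, -⟩ := kind_state_eq_lit hk
    exact x_mem_vars.2 (by omega)

theorem sum_card_elements_le (m : ℕ) (hm : 1 ≤ m) :
    ∑ g ∈ nodes m, 3 * ((system m hm).elements g).card ≤ 100 * (2 * m + 1) ^ 3 := by
  have hroot : ((system m hm).elements root).card ≤ 2 + m * 2 := by
    refine Finset.card_image_le.trans ((Finset.card_union_le _ _).trans
      (Nat.add_le_add Finset.card_le_two ?_))
    rw [Finset.card_product, Nat.card_Icc]
    exact Nat.mul_le_mul (by omega) Finset.card_le_two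
  have hlit : ∀ v b, ((system m hm).elements (lit v b)).card = 0 := fun v b => rfl
  have hstate : ∀ t o k c, ((system m hm).elements (state t o k c)).card ≤ 2 := by
    intro t o k c
    cases hk : kind m (state t o k c) with
    | const b => simp [SDDSystem.elements, system, hk]
    | lit v b => simp [SDDSystem.elements, system, hk]
    | decision E =>
      obtain ⟨-, -, rfl⟩ := kind_state_eq_decision hk
      simp only [SDDSystem.elements, system, hk]
      exact Finset.card_image_le.trans (by simp)
  have h1 : ∑ g ∈ nodes m, 3 * ((system m hm).elements g).card ≤
      3 * (2 + m * 2) + (0 + (stateIndex m).card * 6) := by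
    rw [nodes, Finset.sum_insert (by simp), Finset.sum_union]
    · refine Nat.add_le_add (by omega) (Nat.add_le_add ?_ ?_)
      · refine (Finset.sum_eq_zero fun g hg => ?_).le
        obtain ⟨p, -, rfl⟩ := Finset.mem_image.1 hg
        rw [hlit, mul_zero]
      · refine (Finset.sum_le_card_nsmul _ _ 6 fun g hg => ?_).trans ?_
        · obtain ⟨p, -, rfl⟩ := Finset.mem_image.1 hg
          have := hstate p.1.1 p.1.2 p.2.1 p.2.2
          omega
        · exact Nat.mul_le_mul_right _ Finset.card_image_le
    · rw [Finset.disjoint_left]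
      intro g hg hg'
      obtain ⟨p, -, rfl⟩ := Finset.mem_image.1 hg
      obtain ⟨q, -, h⟩ := Finset.mem_image.1 hg'
      cases h
  have h2 : (stateIndex m).card = (m + 1) * 3 * (m * (m + 2)) := by
    simp [stateIndex]
  rw [h2] at h1
  refine h1.trans ?_
  ring_nf
  nlinarith [Nat.zero_le m, Nat.zero_le (m ^ 2), Nat.zero_le (m ^ 3)]

end Node

theorem arity_F (m : ℕ) : (F m).arity = 2 * m + 1 := by
  simp [BoolFun.arity, F, vars]
  omega

/-- The one-node system for the constant `true`. -/
noncomputable def trueSystem : SDDSystem Var Unit where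
  kind _ := .const true
  tree _ := .leaf (y 0)
  sem _ _ := true
  rank _ := 0
  nodes := {()}
  root := ()
  root_mem := by simp
  const_sem := by rintro _ _ _ ⟨⟩ _; rfl
  lit_mem := by rintro _ _ _ _ ⟨⟩
  lit_sem := by rintro _ _ _ _ ⟨⟩
  dec_tree := by rintro _ _ _ ⟨⟩
  dec_mem := by rintro _ _ _ ⟨⟩
  dec_ne := by rintro _ _ _ ⟨⟩
  dec_rank := by rintro _ _ _ ⟨⟩
  dec_two_le := by rintro _ _ _ ⟨⟩
  dec_ne_bot := by rintro _ _ _ ⟨⟩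
  dec_disjoint := by rintro _ _ _ ⟨⟩
  dec_cover := by rintro _ _ _ ⟨⟩
  dec_sub_ne := by rintro _ _ _ ⟨⟩
  dec_sem := by rintro _ _ _ ⟨⟩

theorem compressedSDDSize_F_le (m : ℕ) :
    (F m).compressedSDDSize ≤ ((100 * (F m).arity ^ 3 : ℕ) : ℕ∞) := by
  -- For `m = 0` the two unconstrained root indices coincide and leave a single element, but the
  -- function is `¬ y 0 ∨ y 0`, a constant.
  rcases Nat.eq_zero_or_pos m with rfl | hm
  · refine (trueSystem.compressedSDDSize_le (F 0) (List.nodup_singleton _) ?_ ?_).trans ?_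
    · intro a
      simp only [trueSystem, F]
      refine Eq.symm (@decide_eq_true _ (Classical.propDecidable _) ?_)
      have hE : E 0 0 a := by simp [E]
      cases h : a (y 0)
      · exact .inl ⟨hE, h⟩
      · exact .inr (.inl ⟨hE, h⟩)
    · rintro _ _ _ _ ⟨⟩
    · simp [SDDSystem.elements, trueSystem]
  · refine ((Node.system m hm).compressedSDDSize_le (F m) (Node.isVTree_tree_root m)
      (fun _ => rfl) (fun g hg v b hk => Node.kind_lit_mem hg hk)).trans (Nat.cast_le.2 ?_)
    rw [arity_F]
    exact Node.sum_card_elements_le m hm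

end GHWB

/-! ### Subfunctions of an SDD along a prefix of the variable ordering. -/

namespace VTree

variable {V : Type}

theorem IsSubtree.trans {S T U : VTree V} (h : S.IsSubtree T) (h' : T.IsSubtree U) :
    S.IsSubtree U := by
  induction h' with
  | refl => exact h
  | left _ ih => exact .left ih
  | right _ ih => exact .right ih

theorem IsSubtree.mem_leaves {S T : VTree V} (h : S.IsSubtree T) {v : V} (hv : v ∈ S.leaves) :
    v ∈ T.leaves := by
  induction h with
  | refl => exact hv
  | left _ ih => exact List.mem_append_left _ ih
  | right _ ih => exact List.mem_append_right _ ih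

/-- The set `S` of variables splits `T`: at each internal node, `S` contains all the variables of
the left child, or none of the variables of the node. -/
def SplitBy (S : Set V) (T : VTree V) : Prop :=
  ∀ L R, (node L R).IsSubtree T → (∀ v ∈ L.leaves, v ∈ S) ∨ ∀ v ∈ (node L R).leaves, v ∉ S

theorem SplitBy.mono {S : Set V} {T U : VTree V} (hT : SplitBy S T) (h : U.IsSubtree T) :
    SplitBy S U :=
  fun L R h' => hT L R (h'.trans h)

/-- The initial segments of the variable ordering split a right-linear vtree. -/
theorem RightLinear.splitBy_take {T : VTree V} (hT : T.RightLinear) (rest : List V)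
    (hnd : (T.leaves ++ rest).Nodup) (j : ℕ) :
    SplitBy {v | v ∈ (T.leaves ++ rest).take j} T := by
  induction T generalizing j with
  | leaf v => rintro L R ⟨⟩
  | node l r _ ih =>
    obtain ⟨⟨v, rfl⟩, hr⟩ := hT
    cases j with
    | zero =>
      intro L R h
      exact .inr fun v _ => by simp
    | succ j =>
      simp only [leaves, List.cons_append, List.nil_append, List.nodup_cons,
        List.take_succ_cons, List.mem_cons] at hnd ⊢
      intro L R h
      cases h with
      | refl => exact .inl fun w hw => .inl (List.mem_singleton.1 hw)
      | left h => cases h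
      | right h =>
        refine (ih hr hnd.2 j L R h).imp (fun h w hw => .inr (h w hw)) fun h' w hw => ?_
        rintro (rfl | hw')
        · exact hnd.1 (List.mem_append_left _ (h.mem_leaves hw))
        · exact h' w hw hw'

end VTree

namespace NNF

variable {V : Type}

/-- Every gate except the unique sink has an outgoing arc. -/
theorem card_gate_le (C : NNF V) : Fintype.card C.Gate ≤ C.size + 1 := by
  classical
  have h : (Finset.univ : Finset C.Gate) ⊆
      insert C.output (Finset.univ.biUnion C.wires) := by
    intro g _
    rw [Finset.mem_insert]
    by_cases hg : g = C.output
    · exact .inl hg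
    · have := (C.sink_iff g).not.2 hg
      push Not at this
      obtain ⟨h, hh⟩ := this
      exact .inr (Finset.mem_biUnion.2 ⟨h, Finset.mem_univ _, hh⟩)
  calc Fintype.card C.Gate = (Finset.univ : Finset C.Gate).card := rfl
    _ ≤ _ := Finset.card_le_card h
    _ ≤ _ := Finset.card_insert_le _ _
    _ ≤ _ := Nat.add_le_add_right Finset.card_biUnion_le _

theorem eval_decision {C : NNF V} {g : C.Gate} {p s : C.Gate → C.Gate}
    (label_eq : C.label g = .disj) (label_conj : ∀ h ∈ C.wires g, C.label h = .conj)
    (wires_conj : ∀ h ∈ C.wires g, p h ≠ s h ∧ (C.wires h : Set C.Gate) = {p h, s h})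
    (a : V → Bool) : C.eval a g = true ↔
      ∃ h ∈ C.wires g, C.eval a (p h) = true ∧ C.eval a (s h) = true := by
  rw [eval_eq, label_eq]
  simp only [decide_eq_true_eq]
  refine exists_congr fun h => and_congr_right fun hh => ?_
  rw [eval_eq, label_conj h hh]
  simp only [decide_eq_true_eq]
  have : ∀ k, k ∈ C.wires h ↔ k = p h ∨ k = s h := fun k => by
    rw [← Finset.mem_coe, (wires_conj h hh).2]
    rfl
  simp [this]

theorem SDDAt.eval_congr {C : NNF V} {c : Bool} {g : C.Gate} {T : VTree V} (h : C.SDDAt c g T)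
    {a b : V → Bool} (hab : ∀ v ∈ T.leaves, a v = b v) : C.eval a g = C.eval b g := by
  induction h with
  | literal g T v d hl hv => simp [eval_eq, hl, hab v hv]
  | constant g T d hl => simp [eval_eq, hl]
  | decision g T L R p s Tp Ts hl hT _ hlc hwc hTp _ hTs _ _ _ _ _ ihp ihs =>
    have hL : ∀ v ∈ L.leaves, a v = b v := fun v hv =>
      hab v (hT.mem_leaves (List.mem_append_left _ hv))
    have hR : ∀ v ∈ R.leaves, a v = b v := fun v hv =>
      hab v (hT.mem_leaves (List.mem_append_right _ hv))
    rw [Bool.eq_iff_iff, eval_decision hl hlc hwc, eval_decision hl hlc hwc]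
    refine exists_congr fun h => and_congr_right fun hh => ?_
    rw [ihp h hh fun v hv => hL v ((hTp h hh).mem_leaves hv),
      ihs h hh fun v hv => hR v ((hTs h hh).mem_leaves hv)]

/-- The function of a gate or of a constant. -/
noncomputable def residualEval (C : NNF V) (b : V → Bool) : C.Gate ⊕ Bool → Bool :=
  Sum.elim (C.eval b) id

/-- If `S` splits the vtree, then giving values to the variables in `S` turns an SDD into the SDD
of one of its gates, or into a constant. -/
theorem SDDAt.exists_residual {C : NNF V} {c : Bool} {g : C.Gate} {T : VTree V}
    (h : C.SDDAt c g T) {S : Set V} (hS : T.SplitBy S) (a : V → Bool) :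
    ∃ o : C.Gate ⊕ Bool, (∀ b, (∀ v ∈ S, b v = a v) → C.eval b g = C.residualEval b o) ∧
      ∀ b b', (∀ v ∉ S, b v = b' v) → C.residualEval b o = C.residualEval b' o := by
  induction h with
  | literal g T v d hl hv =>
    by_cases hvS : v ∈ S
    · exact ⟨.inr (a v == d), fun b hb => by simp [eval_eq, hl, residualEval, hb v hvS],
        fun _ _ _ => rfl⟩
    · exact ⟨.inl g, fun _ _ => rfl, fun b b' hb => by simp [eval_eq, hl, residualEval, hb v hvS]⟩
  | constant g T d hl =>
    exact ⟨.inr d, fun b hb => by simp [eval_eq, hl, residualEval], fun _ _ _ => rfl⟩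
  | decision g T L R p s Tp Ts hl hT h2 hlc hwc hTp hp hTs hs hne hdis hcov hsub ihp ihs =>
    -- If all of `L` is fixed, exactly one prime becomes true and the decision collapses to its sub,
    -- where the induction continues. Otherwise no variable below the node is fixed, and the gate
    -- itself is the residual.
    rcases hS L R hT with hL | hLR
    · obtain ⟨h, hh, hap⟩ := hcov a
      obtain ⟨o, ho, ho'⟩ := ihs h hh (hS.mono ((hTs h hh).trans (.trans (.right (.refl _)) hT)))
      refine ⟨o, fun b hb => ?_, ho'⟩
      rw [← ho b hb]
      have hbp : C.eval b (p h) = true := by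
        rw [← hap]
        exact (hp h hh).eval_congr fun v hv => hb v (hL v ((hTp h hh).mem_leaves hv))
      rw [Bool.eq_iff_iff, eval_decision hl hlc hwc]
      refine ⟨?_, fun H => ⟨h, hh, hbp, H⟩⟩
      rintro ⟨h', hh', H1, H2⟩
      by_cases heq : h' = h
      · rwa [← heq]
      · exact absurd ⟨H1, hbp⟩ (hdis h' hh' h hh heq b)
    · refine ⟨.inl g, fun _ _ => rfl, fun b b' hb => ?_⟩
      have : C.SDDAt c g (.node L R) := .decision g _ L R p s Tp Ts hl (.refl _) h2 hlc hwc hTp hp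
        hTs hs hne hdis hcov hsub
      exact this.eval_congr fun v hv => hb v (hLR v hv)

/-- The number of the subfunctions, under assignments to a set of variables that splits the vtree,
bounds the size from below. -/
theorem SDDAt.card_le_size {C : NNF V} {c : Bool} {T : VTree V} (h : C.SDDAt c C.output T)
    {S : Set V} (hS : T.SplitBy S) {ι : Type} (I : Finset ι) (α : ι → V → Bool)
    (hα : ∀ i ∈ I, ∀ j ∈ I, i ≠ j → ∃ b b', (∀ v ∈ S, b v = α i v) ∧ (∀ v ∈ S, b' v = α j v) ∧
      (∀ v ∉ S, b v = b' v) ∧ C.eval b C.output ≠ C.eval b' C.output) :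
    I.card ≤ C.size + 3 := by
  choose o ho ho' using fun i => h.exists_residual hS (α i)
  have h1 : I.card ≤ Fintype.card (C.Gate ⊕ Bool) := by
    refine Finset.card_le_card_of_injOn (t := Finset.univ) o (fun _ _ => Finset.mem_univ _) ?_
    intro i hi j hj hij
    by_contra hne
    obtain ⟨b, b', hb, hb', hbb, H⟩ := hα i hi j hj hne
    refine H ?_
    rw [ho i b hb, ho j b' hb', hij]
    exact ho' j b b' hbb
  -- The 3 is made up of the output gate and the two constants.
  rw [Fintype.card_sum, Fintype.card_bool] at h1
  have := C.card_gate_le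
  omega

end NNF

/-! ### The exponential lower bound for every variable ordering. -/

theorem Nat.two_pow_le_centralBinom (n : ℕ) : 2 ^ n ≤ n.centralBinom := by
  induction n with
  | zero => simp
  | succ n ih =>
    have h := n.succ_mul_centralBinom_succ
    refine Nat.le_of_mul_le_mul_left (c := n + 1) ?_ (by omega)
    rw [h, pow_succ]
    nlinarith

namespace GHWB

theorem formula_of_y {m i : ℕ} (h1 : 1 ≤ i) (h2 : i < m) {a : Var → Bool}
    (hy : ∀ j, a (y j) = true) (ha : ones m 0 a = i) : Formula m a ↔ a (x i) = true := by
  unfold Formula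
  simp only [E_iff, ha, hy]
  constructor
  · rintro (⟨-, h⟩ | ⟨h, -⟩ | ⟨j, -, -, ⟨-, h⟩ | ⟨⟨h, hx⟩, -⟩⟩)
    · cases h
    · omega
    · cases h
    · rwa [h]
  · intro h
    exact .inr (.inr ⟨i, h1, by omega, .inr ⟨⟨rfl, h⟩, trivial⟩⟩)

/-- The assignment that makes `x i` true for the `i ∈ s` only, and every `y i`. -/
def indicator (s : Finset ℕ) : Var → Bool :=
  Sum.elim (fun i => decide (i ∈ s)) fun _ => true

theorem F_indicator {m i : ℕ} (h1 : 1 ≤ i) (h2 : i < m) {s : Finset ℕ} (hs : s ⊆ Finset.Ioc 0 m)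
    (hc : s.card = i) : (F m).toFun (indicator s) = decide (i ∈ s) := by
  have : ones m 0 (indicator s) = i := by
    rw [ones_indicator hs _ (by simp [indicator]), hc]
  have h := formula_of_y h1 h2 (fun _ => rfl) this
  simp only [F]
  rw [decide_eq_decide, h]
  simp [indicator]

/-- A circuit for `F m` respecting a vtree split by a set of variables that misses `4 t` of the
variables `x 1, …, x m`. -/
theorem two_pow_le_size {m t : ℕ} (ht : 1 ≤ t) (hm : 10 * t ≤ m) {C : NNF Var} {c : Bool}
    {T : VTree Var} (h : C.SDDAt c C.output T) (hC : C.Computes (F m)) {S : Set Var}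
    (hS : T.SplitBy S) {B : Finset ℕ} (hB : ∀ i, i ∈ B ↔ i ∈ Finset.Ioc 0 m ∧ x i ∉ S)
    (hcard : B.card = 4 * t) : 2 ^ t ≤ C.size + 3 := by
  classical
  have hBm : B ⊆ Finset.Ioc 0 m := fun i hi => ((hB i).1 hi).1
  obtain ⟨A, hA⟩ : ∃ A, A = Finset.Ioc 0 m \ B := ⟨_, rfl⟩
  have hAm : A ⊆ Finset.Ioc 0 m := hA ▸ Finset.sdiff_subset
  have hAB : Disjoint A B := hA ▸ Finset.sdiff_disjoint
  have hAcard : A.card = m - 4 * t := by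
    rw [hA, Finset.card_sdiff_of_subset hBm, hcard]
    simp
  obtain ⟨s, K, hs, hK, hKA, hKW⟩ : ∃ s, ∃ K : Finset ℕ, (s = t ∨ s = 5 * t) ∧
      K.card = 2 * t ∧ K ⊆ A ∧ ∀ i ∈ K, s < i ∧ i ≤ s + 4 * t := by
    -- The two windows have `8 * t` indices, of which at most `4 * t` lie in `B`; so one of them has
    -- `2 * t` in `A`.
    have hW : 4 * t ≤ (A ∩ Finset.Ioc t (5 * t)).card + (A ∩ Finset.Ioc (5 * t) (9 * t)).card := by
      have h1 : Finset.Ioc t (5 * t) ∪ Finset.Ioc (5 * t) (9 * t) ⊆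
          (A ∩ Finset.Ioc t (5 * t) ∪ A ∩ Finset.Ioc (5 * t) (9 * t)) ∪ B := by
        intro i hi
        simp only [hA, Finset.mem_union, Finset.mem_inter, Finset.mem_sdiff,
          Finset.mem_Ioc] at hi ⊢
        by_cases hiB : i ∈ B
        · exact .inr hiB
        · refine .inl (hi.imp (fun h => ⟨⟨?_, hiB⟩, h⟩) (fun h => ⟨⟨?_, hiB⟩, h⟩)) <;> omega
      have h2 : (Finset.Ioc t (5 * t) ∪ Finset.Ioc (5 * t) (9 * t)).card = 8 * t := by
        rw [Finset.Ioc_union_Ioc_eq_Ioc (by omega) (by omega), Nat.card_Ioc]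
        omega
      have h3 := (Finset.card_le_card h1).trans (Finset.card_union_le _ _)
      have h4 := Finset.card_union_le (A ∩ Finset.Ioc t (5 * t)) (A ∩ Finset.Ioc (5 * t) (9 * t))
      omega
    have pick : ∀ s, 2 * t ≤ (A ∩ Finset.Ioc s (s + 4 * t)).card → ∃ K : Finset ℕ,
        K.card = 2 * t ∧ K ⊆ A ∧ ∀ i ∈ K, s < i ∧ i ≤ s + 4 * t := by
      intro s hs
      obtain ⟨K, hK, hc⟩ := Finset.exists_subset_card_eq hs
      exact ⟨K, hc, fun i hi => (Finset.mem_inter.1 (hK hi)).1,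
        fun i hi => Finset.mem_Ioc.1 (Finset.mem_inter.1 (hK hi)).2⟩
    have e1 : t + 4 * t = 5 * t := by omega
    have e2 : 5 * t + 4 * t = 9 * t := by omega
    by_cases h1 : 2 * t ≤ (A ∩ Finset.Ioc t (5 * t)).card
    · obtain ⟨K, hK⟩ := pick t (by rwa [e1])
      exact ⟨t, K, .inl rfl, hK⟩
    · obtain ⟨K, hK⟩ := pick (5 * t) (by rw [e2]; omega)
      exact ⟨5 * t, K, .inr rfl, hK⟩
  -- Padding that brings the number of ones in the prefix to exactly `s`. At most `4 * t` elements
  -- are needed, and `A \ K` has that many since `10 * t ≤ m`.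
  obtain ⟨D, hD, hDcard⟩ : ∃ D ⊆ A \ K, D.card = s - t := by
    refine Finset.exists_subset_card_eq ?_
    rw [Finset.card_sdiff_of_subset hKA]
    omega
  have hDA : D ⊆ A := hD.trans Finset.sdiff_subset
  have hDK : Disjoint K D := Finset.disjoint_of_subset_right hD Finset.disjoint_sdiff
  have hI : (Finset.powersetCard t K).card = t.centralBinom := by
    rw [Finset.card_powersetCard, hK, Nat.centralBinom_eq_two_mul_choose]
  refine (Nat.two_pow_le_centralBinom t).trans ?_
  rw [← hI]
  refine h.card_le_size hS _ (fun P => indicator (P ∪ D)) ?_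
  intro P hP P' hP' hne
  rw [Finset.mem_powersetCard] at hP hP'
  obtain ⟨i, hi, hi'⟩ : ∃ i ∈ P, i ∉ P' := by
    by_contra! H
    exact hne (Finset.eq_of_subset_of_card_le H (by omega))
  have hiK := hP.1 hi
  have hiW := hKW i hiK
  -- The unread variables lift the count from `s` to `i`, so that the function returns the bit `x
  -- i`, where `P` and `P'` differ.
  obtain ⟨Q, hQ, hQcard⟩ : ∃ Q ⊆ B, Q.card = i - s :=
    Finset.exists_subset_card_eq (by omega)
  have hSB : ∀ P₀ ⊆ K, ∀ v ∈ S, indicator (P₀ ∪ D ∪ Q) v = indicator (P₀ ∪ D) v := by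
    rintro P₀ - (j | j) hj
    · have : j ∉ Q := fun hjQ => ((hB j).1 (hQ hjQ)).2 hj
      simp [indicator, this]
    · rfl
  have hdis : ∀ P₀ ⊆ K, P₀.card = t → (P₀ ∪ D ∪ Q).card = i := by
    intro P₀ hP₀ hc
    rw [Finset.card_union_of_disjoint, Finset.card_union_of_disjoint]
    · omega
    · exact Finset.disjoint_of_subset_left hP₀ hDK
    · exact Finset.disjoint_of_subset_left (Finset.union_subset (hP₀.trans hKA) hDA)
        (Finset.disjoint_of_subset_right hQ hAB)
  have hsub : ∀ P₀ ⊆ K, P₀ ∪ D ∪ Q ⊆ Finset.Ioc 0 m := fun P₀ hP₀ =>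
    Finset.union_subset ((Finset.union_subset (hP₀.trans hKA) hDA).trans hAm) (hQ.trans hBm)
  refine ⟨indicator (P ∪ D ∪ Q), indicator (P' ∪ D ∪ Q), hSB P hP.1, hSB P' hP'.1, ?_, ?_⟩
  · rintro (j | j) hj
    · have key : ∀ P₀ ⊆ K, j ∉ P₀ ∪ D := by
        intro P₀ hP₀ hjP
        have hjA := Finset.union_subset (hP₀.trans hKA) hDA hjP
        exact Finset.disjoint_left.1 hAB hjA ((hB j).2 ⟨hAm hjA, hj⟩)
      simp only [indicator, Sum.elim_inl]
      rw [decide_eq_decide, Finset.mem_union, Finset.mem_union (s := P' ∪ D)]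
      simp [key P hP.1, key P' hP'.1]
    · rfl
  · have hiD : i ∉ D := Finset.disjoint_left.1 hDK hiK
    have hiQ : i ∉ Q := fun h => Finset.disjoint_left.1 hAB (hKA hiK) (hQ h)
    rw [hC.2, hC.2, F_indicator (by omega) (by omega) (hsub P hP.1) (hdis P hP.1 hP.2),
      F_indicator (by omega) (by omega) (hsub P' hP'.1) (hdis P' hP'.1 hP'.2)]
    simp [hi, hi', hiD, hiQ]

/-- A right-linear vtree is split by a set of variables that misses a prescribed number of the
variables `x 1, …, x m`. -/
theorem exists_splitBy {m k : ℕ} (hk : k ≤ m) {T : VTree Var} (hT : T.RightLinear)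
    (hT' : T.IsVTree) : ∃ (S : Set Var) (B : Finset ℕ), T.SplitBy S ∧
      (∀ i, i ∈ B ↔ i ∈ Finset.Ioc 0 m ∧ x i ∉ S) ∧ B.card = k := by
  classical
  -- The vtree is not assumed to contain all the x-variables; the missing ones are appended to the
  -- ordering.
  obtain ⟨rest, hnd, hmem⟩ : ∃ rest, (T.leaves ++ rest).Nodup ∧
      ∀ i ∈ Finset.Ioc 0 m, x i ∈ T.leaves ++ rest := by
    refine ⟨((vars m).filter (· ∉ T.leaves)).toList, ?_, fun i hi => ?_⟩
    · refine List.Nodup.append hT' (Finset.nodup_toList _) fun v h h' => ?_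
      rw [Finset.mem_toList, Finset.mem_filter] at h'
      exact h'.2 h
    · rw [List.mem_append, Finset.mem_toList, Finset.mem_filter]
      by_cases h : x i ∈ T.leaves
      · exact .inl h
      · exact .inr ⟨Node.x_mem_vars.2 (by rw [Finset.mem_Ioc] at hi; omega), h⟩
  let B (j : ℕ) : Finset ℕ := (Finset.Ioc 0 m).filter fun i => x i ∉ (T.leaves ++ rest).take j
  -- A discrete intermediate value argument: a prefix longer by one variable leaves at most one
  -- index fewer unread, so the count descends from `m` to 0 through every value.
  have hstep : ∀ j, (B j).card ≤ (B (j + 1)).card + 1 := by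
    intro j
    cases hw : (T.leaves ++ rest)[j]? with
    | none =>
      refine le_trans (Finset.card_le_card fun i hi => ?_) (Nat.le_succ _)
      simpa [B, List.take_add_one, hw] using hi
    | some w =>
      refine (Finset.card_le_card (t := insert (Sum.elim id (fun _ => 0) w) (B (j + 1)))
        fun i hi => ?_).trans (Finset.card_insert_le _ _)
      rw [Finset.mem_insert]
      by_cases hiw : x i = w
      · exact .inl (by simp [← hiw])
      · right
        simp only [B, Finset.mem_filter, List.take_add_one, hw, Option.toList_some, List.mem_append,
          List.mem_singleton, hiw, or_false] at hi ⊢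
        exact hi
  have hzero : (B 0).card = m := by simp [B]
  have hex : ∃ j, (B j).card ≤ k := by
    refine ⟨(T.leaves ++ rest).length, ?_⟩
    have : B (T.leaves ++ rest).length = ∅ := by
      rw [Finset.filter_eq_empty_iff]
      intro i hi
      rw [List.take_length, not_not]
      exact hmem i hi
    rw [this, Finset.card_empty]
    exact Nat.zero_le k
  have hfind : (B (Nat.find hex)).card = k := by
    refine le_antisymm (Nat.find_spec hex) ?_
    cases hj : Nat.find hex with
    | zero => rw [hzero]; exact hk
    | succ j =>
      have h1 := Nat.find_min hex (m := j) (by omega)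
      have h2 := hstep j
      omega
  exact ⟨_, B (Nat.find hex), hT.splitBy_take rest hnd (Nat.find hex),
    fun i => Finset.mem_filter, hfind⟩

/-- The function is true at the all-false and all-true assignments, which no literal is, and false
when only `y 0` is true. So the output gate is a decision, with at least two arcs. -/
theorem two_le_size {m : ℕ} (hm : 1 ≤ m) {C : NNF Var} {c : Bool} {T : VTree Var}
    (h : C.SDDAt c C.output T) (hC : C.Computes (F m)) : 2 ≤ C.size := by
  have hF : ∀ a, C.eval a C.output = true ↔ Formula m a := by
    intro a
    rw [hC.2]
    simp [F]
  have e0 : ones m 0 (fun _ => false) = 0 := by simp [ones]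
  have e1 : ones m 0 (fun v => decide (v = y 0)) = 0 := by simp [ones]
  have e2 : ones m 0 (fun _ => true) = m := by simp [ones]
  have h0 : C.eval (fun _ => false) C.output = true := (hF _).2 (.inl ⟨e0, rfl⟩)
  have h1 : ¬ C.eval (fun v => decide (v = y 0)) C.output = true := by
    rw [hF]
    unfold Formula
    simp only [E_iff, e1]
    rintro (⟨-, h⟩ | ⟨h, -⟩ | ⟨i, hi, -, ⟨⟨h, -⟩, -⟩ | ⟨⟨h, -⟩, -⟩⟩)
    · simp at h
    · omega
    · omega
    · omega
  have h2 : C.eval (fun _ => true) C.output = true := (hF _).2 (.inr (.inl ⟨e2, rfl⟩))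
  cases h with
  | literal _ _ v b hl _ =>
    rw [NNF.eval_eq, hl] at h0 h1 h2
    simp only [beq_iff_eq] at h0 h2
    rw [← h0] at h2
    cases h2
  | constant _ _ b hl =>
    rw [NNF.eval_eq, hl] at h0 h1
    exact absurd h0 h1
  | decision _ _ _ _ _ _ _ _ _ _ htwo =>
    exact htwo.trans (Finset.single_le_sum (f := fun g => (C.wires g).card)
      (fun _ _ => Nat.zero_le _) (Finset.mem_univ C.output))

theorem two_pow_le_obddSize {m : ℕ} (hm : 1 ≤ m) :
    ∃ e : ℕ, 2 * m + 1 ≤ 100 * e ∧ ((2 ^ e : ℕ) : ℕ∞) ≤ (F m).obddSize := by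
  -- Below 49 the arity is less than 100, and the trivial bound 2 suffices.
  rcases lt_or_ge m 49 with h | h
  · refine ⟨1, by omega, le_iInf fun C => le_iInf fun ⟨T, _, hC⟩ => le_iInf fun hF => ?_⟩
    exact Nat.cast_le.2 (two_le_size hm hC.2 hF)
  -- One unit of the exponent absorbs the additive 3: `2 ^ t - 3 ≥ 2 ^ (t - 1)` for `t ≥ 3`.
  · refine ⟨m / 10 - 1, by omega, le_iInf fun C => le_iInf fun ⟨T, hT, hC⟩ => le_iInf fun hF => ?_⟩
    obtain ⟨S, B, hS, hB, hcard⟩ := exists_splitBy (m := m) (k := 4 * (m / 10)) (by omega) hT hC.1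
    have h1 := two_pow_le_size (t := m / 10) (by omega) (by omega) hC.2 hF hS hB hcard
    obtain ⟨e, he⟩ : ∃ e, m / 10 = e + 1 + 1 + 1 := ⟨m / 10 - 3, by omega⟩
    refine Nat.cast_le.2 ?_
    rw [he] at h1 ⊢
    rw [Nat.add_sub_cancel]
    have := Nat.one_le_two_pow (n := e)
    simp only [pow_succ] at h1 ⊢
    omega

end GHWB

theorem theorem3 :
    (∀ m : ℕ, (GHWB.F m).arity = 2 * m + 1) ∧
    (∃ K : ℕ, ∀ m : ℕ,
      (GHWB.F m).compressedSDDSize ≤ ((K * (GHWB.F m).arity ^ 3 : ℕ) : ℕ∞)) ∧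
    (∃ c : ℝ, 0 < c ∧ ∀ m : ℕ, 1 ≤ m →
      (2 : ℝ≥0∞) ^ (c * ((GHWB.F m).arity : ℝ)) ≤ ((GHWB.F m).obddSize : ℝ≥0∞)) := by
  refine ⟨GHWB.arity_F, ⟨100, GHWB.compressedSDDSize_F_le⟩, 1 / 100, by norm_num, fun m hm => ?_⟩
  obtain ⟨e, he, h⟩ := GHWB.two_pow_le_obddSize hm
  calc (2 : ℝ≥0∞) ^ (1 / 100 * ((GHWB.F m).arity : ℝ)) ≤ (2 : ℝ≥0∞) ^ (e : ℝ) := by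
        refine ENNReal.rpow_le_rpow_of_exponent_le (by norm_num) ?_
        rw [GHWB.arity_F]
        have : ((2 * m + 1 : ℕ) : ℝ) ≤ ((100 * e : ℕ) : ℝ) := Nat.cast_le.2 he
        push_cast at this ⊢
        linarith
    _ = (((2 ^ e : ℕ) : ℕ∞) : ℝ≥0∞) := by
        rw [ENNReal.rpow_natCast, ENat.toENNReal_coe]
        push_cast
        rfl
    _ ≤ _ := ENat.toENNReal_le.2 h
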